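/- Let $n\ge 1$. Consider rational functions $F=G/H$ with $G,H\in\mathbb{C}[z_1,\dots,z_n]$ coprime and $H(\mathbf 0)\neq 0$, and write $\partial_i=\partial/\partial z_i$. Let $\mathcal D\subset\mathbb{C}^n$ be the open domain of convergence of the power series expansion of $F$ at the origin (the interior of the set of points where it converges absolutely) and $\partial\mathcal D$ its boundary. A *minimal critical point* of $F$ is a point $\mathbf z\in\partial\mathcal D$ such that $$H(\mathbf z)=0,\qquad z_1\,\partial_1H(\mathbf z)=\dots=z_n\,\partial_nH(\mathbf z).$$ It is *non-degenerate* if $\nabla H(\mathbf z)\ne 0$ and, for every $k$ with $\partial_kH(\mathbf z)\neq0$, writing the zero set of $H$ near $\mathbf z$ as the graph $z_k=g\big((z_j)_{j\ne k}\big)$ of an analytic function $g$, the function $\psi=g\cdot\prod_{j\neq k}z_j$ of the $n-1$ variables $(z_j)_{j\neq k}$ has a non-singular Hessian matrix at the corresponding point. $F$ is *combinatorial* if all coefficients of its power series expansion at the origin are non-negative real numbers. Consider the following assumptions. - (A0) $F$ admits at least one minimal critical point; - (A1) $\nabla H$ does not vanish at the minimal critical points; - (A2) $G$ is non-zero at at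 least one minimal critical point; - (A3) all minimal critical points are non-degenerate; - (J1) the Jacobian matrix of the system of $n+2$ polynomials $$H,\quad z_1\partial_1H-\lambda,\ \dots,\ z_n\partial_nH-\lambda,\quad H(tz_1,\dots,tz_n)$$ with respect to the $n+2$ variables $(\mathbf z,\lambda,t)$ is non-singular at every solution in $\mathbb{C}^{n+2}$ of the system. Let $m_d=\binom{d+n}{n}$ be the number of monomials of total degree at most $d$ in $n$ variables. A property of such rational functions holds *generically* if for every pair of positive integers $(d_1,d_2)$ there is a proper algebraic subset $\mathcal C_{d_1,d_2}\subsetneq\mathbb{C}^{m_{d_1}+m_{d_2}}$ such that every $F=G/H$ as above with $\deg G=d_1$ and $\deg H=d_2$ has the property unless the vector formed by the coefficients of $G$ and $H$ lies in $\mathcal C_{d_1,d_2}$. **Proposition.** Each of the following properties holds generically: (A1); if (A0) holds, then (A2) holds; (A3); (J1); if $F$ is combinatorial, then (A0) holds, and so does (A2). -/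

import Mathlib

open Filter Topology

noncomputable section

namespace ACSV

variable {n : ℕ}

/-- The power series expansion at the origin of the rational function `G / H`
(meaningful when `H` does not vanish at the origin). -/
def taylorSeries (G H : MvPolynomial (Fin n) ℂ) : MvPowerSeries (Fin n) ℂ :=
  (G : MvPowerSeries (Fin n) ℂ) * (H : MvPowerSeries (Fin n) ℂ)⁻¹

/-- The open domain of convergence of the expansion of `G / H` at the origin: the interior of the
set of points where the series converges absolutely. -/
def domainOfConvergence (G H : MvPolynomial (Fin n) ℂ) : Set (Fin n → ℂ) :=
  interior {z | Summable fun m : Fin n →₀ ℕ =>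
    ‖MvPowerSeries.coeff m (taylorSeries G H)‖ * ∏ i, ‖z i‖ ^ m i}

/-- The singular variety `H = 0`. -/
def singularVariety (H : MvPolynomial (Fin n) ℂ) : Set (Fin n → ℂ) :=
  {z | MvPolynomial.eval z H = 0}

/-- Minimal points: zeros of `H` on the boundary of the domain of convergence. -/
def IsMinimalPoint (G H : MvPolynomial (Fin n) ℂ) (z : Fin n → ℂ) : Prop :=
  z ∈ frontier (domainOfConvergence G H) ∩ singularVariety H

/-- The value at `z` of the partial derivative `∂H/∂z_i`. -/
def partialAt (H : MvPolynomial (Fin n) ℂ) (i : Fin n) (z : Fin n → ℂ) : ℂ :=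
  MvPolynomial.eval z (MvPolynomial.pderiv i H)

/-- Critical points: solutions of `H = 0`, `z_1 ∂H/∂z_1 = ⋯ = z_n ∂H/∂z_n`. -/
def IsCriticalPoint (H : MvPolynomial (Fin n) ℂ) (z : Fin n → ℂ) : Prop :=
  MvPolynomial.eval z H = 0 ∧ ∀ i j, z i * partialAt H i z = z j * partialAt H j z

def IsMinimalCriticalPoint (G H : MvPolynomial (Fin n) ℂ) (z : Fin n → ℂ) : Prop :=
  IsMinimalPoint G H z ∧ IsCriticalPoint H z

/-- The gradient of `H` does not vanish at `z`. -/
def IsSmoothAt (H : MvPolynomial (Fin n) ℂ) (z : Fin n → ℂ) : Prop :=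
  ∃ k, partialAt H k z ≠ 0

/-- The point of `ℂⁿ` with `k`-th coordinate `w` and the other coordinates given by `y`. -/
def insertCoord (k : Fin n) (y : {j : Fin n // j ≠ k} → ℂ) (w : ℂ) : Fin n → ℂ :=
  fun j => if h : j = k then w else y ⟨j, h⟩

/-- The point `z` with its `k`-th coordinate removed. -/
def removeCoord (k : Fin n) (z : Fin n → ℂ) : {j : Fin n // j ≠ k} → ℂ :=
  fun j => z j

/-- The Hessian matrix of second complex partial derivatives of `f` at `y`. -/
def hessian {ι : Type} [Fintype ι] [DecidableEq ι] (f : (ι → ℂ) → ℂ) (y : ι → ℂ) :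
    Matrix ι ι ℂ :=
  Matrix.of fun i j =>
    fderiv ℂ (fun x => fderiv ℂ f x (Pi.single j 1)) y (Pi.single i 1)

/-- `z` is non-degenerate: `H` is smooth at `z` and, solving `H = 0` near `z` for any
coordinate `z_k` with `∂H/∂z_k ≠ 0` by an analytic implicit function `g` of the other coordinates,
the function `ψ = g · ∏_{j ≠ k} z_j` has a non-singular Hessian matrix at the point
formed by these other coordinates of `z`. -/
def IsNondegenerate (H : MvPolynomial (Fin n) ℂ) (z : Fin n → ℂ) : Prop :=
  IsSmoothAt H z ∧ ∀ k, partialAt H k z ≠ 0 →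
    ∃ g : ({j : Fin n // j ≠ k} → ℂ) → ℂ,
      AnalyticAt ℂ g (removeCoord k z) ∧
      g (removeCoord k z) = z k ∧
      (∀ᶠ y in 𝓝 (removeCoord k z), MvPolynomial.eval (insertCoord k y (g y)) H = 0) ∧
      (hessian (fun y => (∏ j, y j) * g y) (removeCoord k z)).det ≠ 0

/-- `G / H` is combinatorial: all coefficients of its expansion at the origin are non-negative
real numbers. -/
def IsCombinatorial (G H : MvPolynomial (Fin n) ℂ) : Prop :=
  ∀ m : Fin n →₀ ℕ, 0 ≤ (MvPowerSeries.coeff m (taylorSeries G H)).re ∧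
    (MvPowerSeries.coeff m (taylorSeries G H)).im = 0

/-- (A0): there is at least one minimal critical point. -/
def A0 (G H : MvPolynomial (Fin n) ℂ) : Prop :=
  ∃ z, IsMinimalCriticalPoint G H z

/-- (A1): the gradient of `H` does not vanish at the minimal critical points. -/
def A1 (G H : MvPolynomial (Fin n) ℂ) : Prop :=
  ∀ z, IsMinimalCriticalPoint G H z → IsSmoothAt H z

/-- (A2): `G` is non-zero at at least one minimal critical point. -/
def A2 (G H : MvPolynomial (Fin n) ℂ) : Prop :=
  ∃ z, IsMinimalCriticalPoint G H z ∧ MvPolynomial.eval z G ≠ 0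

/-- (A3): all minimal critical points are non-degenerate. -/
def A3 (G H : MvPolynomial (Fin n) ℂ) : Prop :=
  ∀ z, IsMinimalCriticalPoint G H z → IsNondegenerate H z

/-- The system `H, z_1 ∂H/∂z_1 - λ, …, z_n ∂H/∂z_n - λ, H(t z_1, …, t z_n)`. The variable `z_i` is
`X (inl i)`, the variable `λ` is `X (inr 0)` and the variable `t` is `X (inr 1)`. -/
def extendedSystem (H : MvPolynomial (Fin n) ℂ) :
    Fin n ⊕ Fin 2 → MvPolynomial (Fin n ⊕ Fin 2) ℂ
  | Sum.inr 0 => MvPolynomial.rename Sum.inl H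
  | Sum.inl i =>
      MvPolynomial.X (Sum.inl i) * MvPolynomial.rename Sum.inl (MvPolynomial.pderiv i H)
        - MvPolynomial.X (Sum.inr 0)
  | Sum.inr 1 =>
      MvPolynomial.aeval
        (fun i => (MvPolynomial.X (Sum.inr 1) * MvPolynomial.X (Sum.inl i) :
          MvPolynomial (Fin n ⊕ Fin 2) ℂ)) H

/-- The Jacobian matrix of the extended system with respect to the variables `z`, `λ`, `t`,
at the point `x`. -/
def extendedJacobian (H : MvPolynomial (Fin n) ℂ) (x : Fin n ⊕ Fin 2 → ℂ) :
    Matrix (Fin n ⊕ Fin 2) (Fin n ⊕ Fin 2) ℂ :=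
  Matrix.of fun e v => MvPolynomial.eval x (MvPolynomial.pderiv v (extendedSystem H e))

/-- (J1): the Jacobian matrix of the extended system is non-singular at its solutions. -/
def J1 (H : MvPolynomial (Fin n) ℂ) : Prop :=
  ∀ x : Fin n ⊕ Fin 2 → ℂ, (∀ e, MvPolynomial.eval x (extendedSystem H e) = 0) →
    (extendedJacobian H x).det ≠ 0

/-- A proper algebraic subset of the affine space `ℂ^σ`: the common zeros of a set of polynomials,
different from the whole space. -/
def IsProperAlgebraicSubset {σ : Type} (C : Set (σ → ℂ)) : Prop :=
  C ≠ Set.univ ∧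
    ∃ S : Set (MvPolynomial σ ℂ), C = {x | ∀ p ∈ S, MvPolynomial.eval x p = 0}

/-- The exponents of the monomials in `n` variables of total degree at most `d`. -/
abbrev Exponents (n d : ℕ) : Type := {m : Fin n →₀ ℕ // m.degree ≤ d}

/-- The vector of the coefficients of `G` in degree at most `d₁` and of `H` in degree at
most `d₂`. -/
def coeffVector (d₁ d₂ : ℕ) (G H : MvPolynomial (Fin n) ℂ) :
    Exponents n d₁ ⊕ Exponents n d₂ → ℂ :=
  Sum.elim (fun m => MvPolynomial.coeff m.1 G) (fun m => MvPolynomial.coeff m.1 H)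

/-- A property `P` of rational functions `G / H`, written with `G` and `H` coprime and
`H(0) ≠ 0`, holds generically: for all positive degrees `d₁`, `d₂` there is a proper algebraic subset
of the space of coefficients, off which `P` holds for all such fractions with numerator of
degree `d₁` and denominator of degree `d₂`. -/
def Generically (n : ℕ)
    (P : MvPolynomial (Fin n) ℂ → MvPolynomial (Fin n) ℂ → Prop) : Prop :=
  ∀ d₁ d₂ : ℕ, 0 < d₁ → 0 < d₂ →
    ∃ C : Set (Exponents n d₁ ⊕ Exponents n d₂ → ℂ), IsProperAlgebraicSubset C ∧
      ∀ G H : MvPolynomial (Fin n) ℂ,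
        G.totalDegree = d₁ → H.totalDegree = d₂ →
        IsRelPrime G H → MvPolynomial.eval 0 H ≠ 0 →
        coeffVector d₁ d₂ G H ∉ C → P G H

end ACSV

end

/-! The genericity statements about (J1) and (A2) come from an algebraic form of transversality.
Take a polynomial system in the coefficients of `G`, `H` and some unknowns. Either a nonzero
polynomial in the coefficients alone vanishes whenever the system is solvable, or the system has a
solution in an extension `K` of ℂ where the coefficients are algebraically independent
(`exists_eliminant`). In the second case, characteristic zero provides derivations of `K` with
arbitrary values on the coefficients (`exists_derivation_of_algebraicIndependent`). Differentiating
the equations along derivations that move `H` by `1` or by `X i` kills every left null vector of the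
Jacobian. This proves (J1), and it forbids `G = 0` at a critical point, where there would be one
equation more than unknowns.

At `t = 1`, (J1) says that `λ ≠ 0` and that the linearized critical point equations have trivial
kernel. A null vector of the Hessian of `ψ` lifts to the tangent space of `H = 0` and lies in that
kernel. Hence (J1) makes all critical points non-degenerate, which gives (A3) and (A1).

In the combinatorial case, generically `H` has on each axis a zero where `G` does not vanish, so the
domain of convergence is bounded. The product of the moduli then has a maximum on its closure, at a
point with positive moduli `x`. A Pringsheim argument places a zero of `H` where each positive ray
leaves the domain (`IsCombinatorial.exists_pole_on_ray`). On the rays close to that of `x`,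
maximality confines this zero to a short interval; a first-order expansion of `H` in logarithmic
coordinates then gives the critical point equations at `x`. Finally (A2) follows from (A0) as
before. -/

noncomputable section

namespace ACSV

variable {n : ℕ}

open MvPolynomial
open scoped ContDiff

/-! ### Derivations of extension fields and elimination -/

/-- A field extension of a field of characteristic zero is formally smooth. -/
theorem formallySmooth_of_charZero (k K : Type*) [Field k] [Field K] [Algebra k K] [CharZero k] :
    Algebra.FormallySmooth k K := by
  obtain ⟨s, hs⟩ := exists_isTranscendenceBasis k K
  -- Over the purely transcendental subfield the extension is algebraic, hence separable in
  -- characteristic zero.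
  have : Algebra.IsAlgebraic (IntermediateField.adjoin k (Set.range ((↑) : s → K))) K :=
    hs.isAlgebraic_field
  exact Algebra.FormallySmooth.of_algebraicIndependent_of_isSeparable hs.1

/-- Derivations can be prescribed arbitrarily on algebraically independent elements of a field of
characteristic zero. -/
theorem exists_derivation_of_algebraicIndependent {σ k K : Type*} [Field k] [CharZero k] [Field K]
    [Algebra k K] {c : σ → K} (hc : AlgebraicIndependent k c) (d : σ → K) :
    ∃ D : Derivation k K K, ∀ s, D (c s) = d s := by
  let B := MvPolynomial σ k
  let algB : Algebra B K := (MvPolynomial.aeval c).toRingHom.toAlgebra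
  have hinj : Function.Injective (algebraMap B K) := hc
  have : FaithfulSMul B K := (faithfulSMul_iff_algebraMap_injective B K).2 hinj
  let : Algebra (FractionRing B) K := FractionRing.liftAlgebra B K
  have : IsScalarTower B (FractionRing B) K := inferInstance
  have : CharZero (FractionRing B) :=
    charZero_of_injective_algebraMap (FaithfulSMul.algebraMap_injective k (FractionRing B))
  have h1 : Algebra.FormallySmooth (FractionRing B) K := formallySmooth_of_charZero _ _
  have h2 : Algebra.FormallySmooth B (FractionRing B) :=
    .of_isLocalization (nonZeroDivisors _)
  have h3 : Algebra.FormallySmooth B K := .comp _ (FractionRing B) _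
  -- The dual numbers `K[ε]` become a `B`-algebra through `X s ↦ c s + ε d s`; the projection to `K`
  -- is then `B`-linear with square-zero kernel.
  let φ : B →ₐ[k] TrivSqZeroExt K K :=
    MvPolynomial.aeval fun s => TrivSqZeroExt.inl (c s) + TrivSqZeroExt.inr (d s)
  let algT : Algebra B (TrivSqZeroExt K K) := φ.toRingHom.toAlgebra
  have hfst : ∀ b, (φ b).fst = MvPolynomial.aeval c b := by
    intro b
    have : (TrivSqZeroExt.fstHom k K K).comp φ = MvPolynomial.aeval c := by
      ext s; simp [φ]
    exact DFunLike.congr_fun this b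
  let g : TrivSqZeroExt K K →ₐ[B] K :=
    { (TrivSqZeroExt.fstHom k K K).toRingHom with commutes' := hfst }
  have hg : Function.Surjective g := fun x => ⟨TrivSqZeroExt.inl x, rfl⟩
  have hnil : IsNilpotent (RingHom.ker (g : TrivSqZeroExt K K →+* K)) := by
    refine ⟨2, (pow_two (M := Ideal (TrivSqZeroExt K K)) _).trans ?_⟩
    rw [Ideal.zero_eq_bot, eq_bot_iff, Ideal.mul_le]
    intro x hx y hy
    have hx' : x.fst = 0 := hx
    have hy' : y.fst = 0 := hy
    rw [Ideal.mem_bot]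
    ext <;> simp [hx', hy']
  -- The lift of the identity has the form `x ↦ x + ε D x`. Multiplicativity is the Leibniz rule for
  -- `D`, and `B`-linearity gives `D (c s) = d s`.
  let f := Algebra.FormallySmooth.liftOfSurjective (AlgHom.id B K) g hg hnil
  have hf : ∀ x, (f x).fst = x := fun x =>
    Algebra.FormallySmooth.liftOfSurjective_apply (AlgHom.id B K) g hg hnil x
  have hfB : ∀ b : B, f (MvPolynomial.aeval c b) = φ b := fun b => f.commutes b
  refine ⟨Derivation.mk' 
    { toFun := fun x => (f x).snd
      map_add' := fun x y => by simp
      map_smul' := fun a x => ?_ } ?_, fun s => ?_⟩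
  · have h := hfB (MvPolynomial.C a)
    rw [MvPolynomial.aeval_C, MvPolynomial.algHom_C] at h
    have h' : algebraMap k (TrivSqZeroExt K K) a = TrivSqZeroExt.inl (algebraMap k K a) := rfl
    simp [Algebra.smul_def, h, h']
  · intro x y
    simp [hf, mul_comm]
  · have h := hfB (MvPolynomial.X s)
    rw [MvPolynomial.aeval_X] at h
    have h' : φ (MvPolynomial.X s) = TrivSqZeroExt.inl (c s) + TrivSqZeroExt.inr (d s) :=
      MvPolynomial.aeval_X _ _
    change (f (c s)).snd = d s
    rw [h, h']
    simp

/-- Elimination: if a polynomial system with parameters has no solution in any field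
extension in which the parameters are generic (derivations can be prescribed on them), then
the parameters of the solvable systems satisfy a nonzero polynomial equation. -/
theorem exists_eliminant {σ v : Type} (S : Set (MvPolynomial (σ ⊕ v) ℂ))
    (h : ∀ (K : Type) [Field K] [Algebra ℂ K] (φ : MvPolynomial (σ ⊕ v) ℂ →ₐ[ℂ] K),
      (∀ p ∈ S, φ p = 0) →
      (∀ d : σ → K, ∃ D : Derivation ℂ K K, ∀ s, D (φ (.X (.inl s))) = d s) → False) :
    ∃ Q : MvPolynomial σ ℂ, Q ≠ 0 ∧ ∀ φ : MvPolynomial (σ ⊕ v) ℂ →ₐ[ℂ] ℂ,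
      (∀ p ∈ S, φ p = 0) → MvPolynomial.eval (fun s => φ (.X (.inl s))) Q = 0 := by
  by_cases hQ : ∃ Q : MvPolynomial σ ℂ, Q ≠ 0 ∧ MvPolynomial.rename Sum.inl Q ∈ Ideal.span S
  · obtain ⟨Q, hQ0, hQS⟩ := hQ
    refine ⟨Q, hQ0, fun φ hφ => ?_⟩
    have h1 : Ideal.span S ≤ RingHom.ker φ := Ideal.span_le.2 fun p hp => hφ p hp
    have h2 : φ (MvPolynomial.rename Sum.inl Q) = 0 := h1 hQS
    rw [← h2, ← MvPolynomial.coe_aeval_eq_eval]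
    have : (MvPolynomial.aeval fun s => φ (.X (.inl s))) = φ.comp (MvPolynomial.rename Sum.inl) := by
      ext s; simp
    exact DFunLike.congr_fun this Q
  · exfalso
    push Not at hQ
    let f : MvPolynomial σ ℂ →+* MvPolynomial (σ ⊕ v) ℂ := (MvPolynomial.rename Sum.inl).toRingHom
    have hbot : (Ideal.span S).comap f = ⊥ := by
      rw [eq_bot_iff]
      intro Q hQ'
      by_contra hne
      exact hQ Q hne hQ'
    -- As the ideal meets the polynomials in the parameters only in `0`, some prime above it does
    -- too. In the fraction field of the quotient the parameters stay algebraically independent and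
    -- the system is solved.
    obtain ⟨P, hP, hSP, hPf⟩ := Ideal.exists_comap_eq_of_mem_minimalPrimes f ⊥ (I := Ideal.span S)
      (by rw [hbot]; exact (Ideal.minimalPrimes_eq_subsingleton_self (I := (⊥ : Ideal (MvPolynomial σ ℂ)))) ▸ rfl)
    let R := MvPolynomial (σ ⊕ v) ℂ ⧸ P
    let φ : MvPolynomial (σ ⊕ v) ℂ →ₐ[ℂ] FractionRing R :=
      (IsScalarTower.toAlgHom ℂ R (FractionRing R)).comp (Ideal.Quotient.mkₐ ℂ P)
    have hφ : ∀ p, φ p = 0 ↔ p ∈ P := by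
      intro p
      change algebraMap R (FractionRing R) (Ideal.Quotient.mk P p) = 0 ↔ _
      rw [FaithfulSMul.algebraMap_eq_zero_iff, Ideal.Quotient.eq_zero_iff_mem]
    refine h (FractionRing R) φ (fun p hp => (hφ p).2 (hSP (Ideal.subset_span hp))) fun d => ?_
    refine exists_derivation_of_algebraicIndependent ?_ d
    rw [algebraicIndependent_iff]
    intro Q hQ0
    have : (MvPolynomial.aeval fun s => φ (.X (.inl s))) = φ.comp (MvPolynomial.rename Sum.inl) := by
      ext s; simp
    rw [this] at hQ0
    have h2 : Q ∈ P.comap f := (hφ _).1 hQ0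
    rwa [hPf] at h2

/-! ### Derivations acting on polynomials and their values -/

/-- The action of a derivation on the coefficients of a polynomial. -/
def derivCoeffs {ι K : Type*} [Field K] [Algebra ℂ K] (D : Derivation ℂ K K) :
    MvPolynomial ι K →+ MvPolynomial ι K where
  toFun p := ∑ m ∈ p.support, monomial m (D (coeff m p))
  map_zero' := by simp
  map_add' p q := by
    classical
    ext m
    simp only [coeff_sum, coeff_monomial, coeff_add, Finset.sum_ite_eq', mem_support_iff]
    by_cases hp : coeff m p = 0 <;> by_cases hq : coeff m q = 0 <;>
      by_cases hpq : coeff m p + coeff m q = 0 <;> simp_all [← map_add]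

section

variable {ι K : Type*} [Field K] [Algebra ℂ K] (D : Derivation ℂ K K)

theorem coeff_derivCoeffs (p : MvPolynomial ι K) (m : ι →₀ ℕ) :
    coeff m (derivCoeffs D p) = D (coeff m p) := by
  classical
  change coeff m (∑ m ∈ p.support, monomial m (D (coeff m p))) = _
  by_cases hp : coeff m p = 0 <;> simp [coeff_sum, coeff_monomial, hp]

theorem derivCoeffs_monomial (m : ι →₀ ℕ) (a : K) :
    derivCoeffs D (monomial m a) = monomial m (D a) := by
  classical
  ext k
  rw [coeff_derivCoeffs, coeff_monomial, coeff_monomial]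
  split_ifs <;> simp

theorem derivCoeffs_mul_X (p : MvPolynomial ι K) (i : ι) :
    derivCoeffs D (p * X i) = derivCoeffs D p * X i := by
  classical
  ext k
  rw [coeff_derivCoeffs, coeff_mul_X', coeff_mul_X', coeff_derivCoeffs]
  split_ifs <;> simp

theorem derivCoeffs_pderiv (p : MvPolynomial ι K) (i : ι) :
    derivCoeffs D (pderiv i p) = pderiv i (derivCoeffs D p) := by
  classical
  induction p using MvPolynomial.induction_on' with
  | monomial m a => simp [pderiv_monomial, derivCoeffs_monomial, mul_comm]
  | add p q hp hq => rw [map_add, map_add, map_add, map_add, hp, hq]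

/-- The chain rule for derivations. -/
theorem derivation_eval [Fintype ι] (z : ι → K) (p : MvPolynomial ι K) :
    D (eval z p) = eval z (derivCoeffs D p) + ∑ j, eval z (pderiv j p) * D (z j) := by
  classical
  induction p using MvPolynomial.induction_on with
  | C a =>
    rw [← monomial_zero', derivCoeffs_monomial]
    simp
  | add p q hp hq => simp only [map_add, hp, hq, add_mul, Finset.sum_add_distrib]; ring
  | mul_X p i hp =>
    rw [derivCoeffs_mul_X]
    simp only [map_mul, eval_X, Derivation.leibniz, hp, smul_eq_mul, pderiv_X, map_add,
      add_mul, Finset.sum_add_distrib]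
    have : ∀ j, eval z (Pi.single (M := fun _ => MvPolynomial ι K) j 1 i) =
        if i = j then 1 else 0 := by
      intro j
      rw [Pi.single_apply]
      split_ifs <;> simp
    simp only [this, mul_ite, mul_one, mul_zero, ite_mul, zero_mul, Finset.sum_ite_eq,
      Finset.mem_univ, if_true, mul_add, Finset.mul_sum]
    simp only [mul_left_comm, mul_comm]
    ring

end

/-! ### Critical points over a field with generic coefficients -/

/-- The Jacobian matrix of the critical point equations with respect to the variables `z`, `λ`
and a further variable, completed by a row `r`. -/
def borderedJacobian {R : Type*} [CommRing R] (H : MvPolynomial (Fin n) R) (z : Fin n → R)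
    (r : Fin n ⊕ Fin 2 → R) : Matrix (Fin n ⊕ Fin 2) (Fin n ⊕ Fin 2) R :=
  Matrix.of fun
    | Sum.inr 0 => Sum.elim (fun j => eval z (pderiv j H)) ![0, 0]
    | Sum.inl i => Sum.elim (fun j => eval z (pderiv j (X i * pderiv i H))) ![-1, 0]
    | Sum.inr 1 => r

/-- The gradient of `H(tz)` in the variables `z`, `λ`, `t`. -/
def scaledRow {R : Type*} [CommRing R] (H : MvPolynomial (Fin n) R) (z : Fin n → R) (t : R) :
    Fin n ⊕ Fin 2 → R :=
  Sum.elim (fun j => t * eval (fun i => t * z i) (pderiv j H))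
    ![0, ∑ j, z j * eval (fun i => t * z i) (pderiv j H)]

/-- The gradient of `G` in the variables `z`, `λ`, `t`. -/
def gradientRow {R : Type*} [CommRing R] (G : MvPolynomial (Fin n) R) (z : Fin n → R) :
    Fin n ⊕ Fin 2 → R :=
  Sum.elim (fun j => eval z (pderiv j G)) ![0, 0]

/-- The coefficients of `G` and `H` in degrees at most `d₁` and `d₂` can be given arbitrary
derivatives. -/
def IsGenericPair {K : Type*} [Field K] [Algebra ℂ K] (d₁ d₂ : ℕ)
    (G H : MvPolynomial (Fin n) K) : Prop :=
  ∀ A B : MvPolynomial (Fin n) K, A.totalDegree ≤ d₁ → B.totalDegree ≤ d₂ →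
    ∃ D : Derivation ℂ K K, derivCoeffs D G = A ∧ derivCoeffs D H = B

section

variable {K : Type*} [Field K] [Algebra ℂ K] {d₁ d₂ : ℕ} {G H : MvPolynomial (Fin n) K}

/-- Let `D` move only the constant term of `H`, at speed `1`. If `l = 0`, then for each `j` either
`∂_j H` vanishes at `z` or `z j = 0`, and then `D (z j) = 0`. So differentiating `H(z) = 0` leaves
`0 = 1`. -/
theorem IsGenericPair.lambda_ne_zero (hg : IsGenericPair d₁ d₂ G H) {z : Fin n → K} {l : K}
    (hH : eval z H = 0) (hz : ∀ i, z i * eval z (pderiv i H) = l) : l ≠ 0 := by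
  rintro rfl
  obtain ⟨D, -, hD⟩ := hg 0 1 (by simp) (by simp)
  have h := derivation_eval D z H
  rw [hH, hD, map_zero, map_one, Finset.sum_eq_zero, add_zero] at h
  · exact zero_ne_one h
  · intro j _
    rcases mul_eq_zero.1 (hz j) with h0 | h0 <;> simp [h0]

/-- Applying `D` to the critical point equations and combining the results with the weights `w`
eliminates the unknown derivative of `l`, and reduces those of `z` to the contribution of the last
row. That row is left free in order to serve both for `H(tz)` and for `G`. -/
theorem vecMul_borderedJacobian {z : Fin n → K} {l : K} {r w : Fin n ⊕ Fin 2 → K}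
    (hH : eval z H = 0) (hz : ∀ i, z i * eval z (pderiv i H) = l) (hr : r (.inr 0) = 0)
    (hw : Matrix.vecMul w (borderedJacobian H z r) = 0) :
    ∑ i, w (.inl i) = 0 ∧ w (.inr 1) * r (.inr 1) = 0 ∧
    ∀ D : Derivation ℂ K K,
      w (.inr 0) * eval z (derivCoeffs D H) +
        ∑ i, w (.inl i) * (z i * eval z (pderiv i (derivCoeffs D H))) =
      w (.inr 1) * ∑ j, r (.inl j) * D (z j) := by
  have hcol : ∀ v, ∑ i, w (.inl i) * borderedJacobian H z r (.inl i) v +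
      (w (.inr 0) * borderedJacobian H z r (.inr 0) v +
        w (.inr 1) * borderedJacobian H z r (.inr 1) v) = 0 := by
    intro v
    have := congrFun hw v
    simpa [Matrix.vecMul, dotProduct, Fintype.sum_sum_type] using this
  have h0 : ∑ i, w (.inl i) = 0 := by
    have := hcol (.inr 0)
    simpa [borderedJacobian, hr] using this
  refine ⟨h0, ?_, fun D => ?_⟩
  · have := hcol (.inr 1)
    simpa [borderedJacobian] using this
  · have h1 := derivation_eval D z H
    rw [hH, map_zero] at h1
    have h2 : ∀ i, D l = z i * eval z (pderiv i (derivCoeffs D H)) +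
        ∑ j, eval z (pderiv j (X i * pderiv i H)) * D (z j) := by
      intro i
      have hc : derivCoeffs D (X i * pderiv i H) = X i * pderiv i (derivCoeffs D H) := by
        rw [mul_comm, derivCoeffs_mul_X, derivCoeffs_pderiv, mul_comm]
      have := derivation_eval D z (X i * pderiv i H)
      rwa [hc, (eval z).map_mul, (eval z).map_mul, eval_X, hz i] at this
    have h3 : ∑ j, (∑ i, w (.inl i) * borderedJacobian H z r (.inl i) (.inl j) +
      (w (.inr 0) * borderedJacobian H z r (.inr 0) (.inl j) +
        w (.inr 1) * borderedJacobian H z r (.inr 1) (.inl j))) * D (z j) = 0 :=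
      Finset.sum_eq_zero fun j _ => by rw [hcol, zero_mul]
    have h4 : ∑ i, w (.inl i) * D l = 0 := by rw [← Finset.sum_mul, h0, zero_mul]
    simp only [borderedJacobian, Matrix.of_apply, Sum.elim_inl, add_mul, Finset.sum_add_distrib,
      Finset.sum_mul, mul_assoc, ← Finset.mul_sum] at h3
    rw [Finset.sum_comm] at h3
    simp only [← Finset.mul_sum] at h3
    have h5 : ∑ i, w (.inl i) * D l = ∑ i, w (.inl i) *
        (z i * eval z (pderiv i (derivCoeffs D H))) + ∑ i, w (.inl i) *
        ∑ j, eval z (pderiv j (X i * pderiv i H)) * D (z j) := by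
      rw [← Finset.sum_add_distrib]
      exact Finset.sum_congr rfl fun i _ => by rw [h2 i, mul_add]
    rw [h4] at h5
    linear_combination -h3 - h5 - w (.inr 0) * h1

/-- A left null vector yields a linear relation satisfied by every perturbation of `H` of degree at
most `d₂`. Testing it on `1` and on the variables expresses all entries of the vector through the
last one, which the columns of `λ` and `t` then annihilate. -/
theorem IsGenericPair.det_scaledRow_ne_zero (hg : IsGenericPair d₁ d₂ G H) (hn : 1 ≤ n)
    (hd₂ : 0 < d₂) {z : Fin n → K} {l t : K} (hH : eval z H = 0)
    (hz : ∀ i, z i * eval z (pderiv i H) = l) (ht : eval (fun i => t * z i) H = 0) :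
    (borderedJacobian H z (scaledRow H z t)).det ≠ 0 := by
  intro hdet
  obtain ⟨w, hw0, hw⟩ := Matrix.exists_vecMul_eq_zero_iff.2 hdet
  obtain ⟨hs, hwt, hrel⟩ := vecMul_borderedJacobian hH hz (by simp [scaledRow]) hw
  have hl := hg.lambda_ne_zero hH hz
  have hzi : ∀ i, z i ≠ 0 := fun i h => hl (by rw [← hz i, h, zero_mul])
  -- The derivative of `H(tz) = 0` replaces the unknown `D (z j)` by the perturbation of `H` at
  -- `tz`; the term in `D t` disappears by the column of `t`.
  have hrel' : ∀ D : Derivation ℂ K K,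
      w (.inr 0) * eval z (derivCoeffs D H) +
        ∑ i, w (.inl i) * (z i * eval z (pderiv i (derivCoeffs D H))) +
      w (.inr 1) * eval (fun i => t * z i) (derivCoeffs D H) = 0 := by
    intro D
    have h1 := derivation_eval D (fun i => t * z i) H
    rw [ht, map_zero] at h1
    have h2 : ∑ j, eval (fun i => t * z i) (pderiv j H) * D (t * z j) =
        ∑ j, scaledRow H z t (.inl j) * D (z j) + scaledRow H z t (.inr 1) * D t := by
      simp only [scaledRow, Sum.elim_inl, Sum.elim_inr, Matrix.cons_val_one,
        Matrix.cons_val_fin_one, Finset.sum_mul, ← Finset.sum_add_distrib]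
      refine Finset.sum_congr rfl fun j _ => ?_
      rw [D.leibniz]
      simp only [smul_eq_mul]
      ring
    rw [h2] at h1
    linear_combination hrel D - w (.inr 1) * h1 - D t * hwt
  have hA : w (.inr 0) + w (.inr 1) = 0 := by
    obtain ⟨D, -, hD⟩ := hg 0 1 (by simp) (by simp)
    have := hrel' D
    simpa [hD] using this
  have hB : ∀ i, w (.inl i) = w (.inr 1) * (1 - t) := by
    intro i
    obtain ⟨D, -, hD⟩ := hg 0 (X i) (by simp) (by simpa [Nat.succ_le_iff] using hd₂)
    have h := hrel' D
    rw [hD] at h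
    have h2 : ∀ j, eval z (pderiv j (X i)) = if j = i then 1 else 0 := by
      intro j
      rw [pderiv_X, Pi.single_apply]
      by_cases hji : j = i <;> simp [hji, eq_comm (a := i)]
    simp only [eval_X, h2, mul_ite, mul_one, mul_zero, Finset.sum_ite_eq', Finset.mem_univ,
      if_true] at h
    have h3 : (w (.inl i) - w (.inr 1) * (1 - t)) * z i = 0 := by
      linear_combination h - z i * hA
    exact sub_eq_zero.1 ((mul_eq_zero.1 h3).resolve_right (hzi i))
  have : CharZero K := charZero_of_injective_algebraMap (algebraMap ℂ K).injective
  have hn0 : (n : K) ≠ 0 := by exact_mod_cast (by omega : n ≠ 0)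
  -- The sum of the `w (.inl i)` is `n (1 - t) w (.inr 1) = 0`, which settles `t ≠ 1`. For `t = 1`,
  -- the last entry of the column of `t` is `n l ≠ 0`.
  have hC : w (.inr 1) = 0 := by
    simp only [hB, Finset.sum_const, Finset.card_univ, Fintype.card_fin, nsmul_eq_mul] at hs
    rcases mul_eq_zero.1 ((mul_eq_zero.1 hs).resolve_left hn0) with h | h
    · exact h
    · have ht1 : t = 1 := (sub_eq_zero.1 h).symm
      refine (mul_eq_zero.1 hwt).resolve_right ?_
      simp only [scaledRow, ht1, one_mul, Sum.elim_inr, Matrix.cons_val_one,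
        Matrix.cons_val_fin_one, hz, Finset.sum_const, Finset.card_univ, Fintype.card_fin,
        nsmul_eq_mul]
      exact mul_ne_zero hn0 hl
  refine hw0 (funext fun v => ?_)
  rcases v with i | v
  · simp [hB i, hC]
  · fin_cases v
    · simpa [hC] using hA
    · exact hC

/-- The same argument for `n + 2` equations in only `n + 1` unknowns: independent perturbations of
`G` and `H` make a left null vector vanish, although one must exist. -/
theorem IsGenericPair.eval_ne_zero_of_critical (hg : IsGenericPair d₁ d₂ G H)
    (hd₂ : 0 < d₂) {z : Fin n → K} {l : K} (hH : eval z H = 0)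
    (hz : ∀ i, z i * eval z (pderiv i H) = l) : eval z G ≠ 0 := by
  intro hG
  -- The variable `t` does not occur in this system, so its column is zero.
  have hdet : (borderedJacobian H z (gradientRow G z)).det = 0 :=
    Matrix.det_eq_zero_of_column_eq_zero (.inr 1) fun v => by
      rcases v with i | v
      · simp [borderedJacobian]
      · fin_cases v <;> simp [borderedJacobian, gradientRow]
  obtain ⟨w, hw0, hw⟩ := Matrix.exists_vecMul_eq_zero_iff.2 hdet
  obtain ⟨hs, -, hrel⟩ := vecMul_borderedJacobian hH hz (by simp [gradientRow]) hw
  have hl := hg.lambda_ne_zero hH hz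
  have hzi : ∀ i, z i ≠ 0 := fun i h => hl (by rw [← hz i, h, zero_mul])
  have hrel' : ∀ D : Derivation ℂ K K,
      w (.inr 0) * eval z (derivCoeffs D H) +
        ∑ i, w (.inl i) * (z i * eval z (pderiv i (derivCoeffs D H))) +
      w (.inr 1) * eval z (derivCoeffs D G) = 0 := by
    intro D
    have h1 := derivation_eval D z G
    rw [hG, map_zero] at h1
    have h2 := hrel D
    simp only [gradientRow, Sum.elim_inl] at h2
    linear_combination h2 - w (.inr 1) * h1
  have hA : w (.inr 0) = 0 := by
    obtain ⟨D, hD', hD⟩ := hg 0 1 (by simp) (by simp)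
    have := hrel' D
    simpa [hD, hD'] using this
  have hC : w (.inr 1) = 0 := by
    obtain ⟨D, hD', hD⟩ := hg 1 0 (by simp) (by simp)
    have := hrel' D
    simpa [hD, hD'] using this
  have hB : ∀ i, w (.inl i) = 0 := by
    intro i
    obtain ⟨D, hD', hD⟩ := hg 0 (X i) (by simp) (by simpa [Nat.succ_le_iff] using hd₂)
    have h := hrel' D
    rw [hD, hA, hC] at h
    have h2 : ∀ j, eval z (pderiv j (X i)) = if j = i then 1 else 0 := by
      intro j
      rw [pderiv_X, Pi.single_apply]
      by_cases hji : j = i <;> simp [hji, eq_comm (a := i)]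
    simp only [h2, mul_ite, mul_one, mul_zero, Finset.sum_ite_eq', Finset.mem_univ, zero_mul,
      zero_add, add_zero, if_true] at h
    exact (mul_eq_zero.1 h).resolve_right (hzi i)
  refine hw0 (funext fun v => ?_)
  rcases v with i | v
  · exact hB i
  · fin_cases v
    · exact hA
    · exact hC

/-- Two equations in the single unknown `u`. Moving `G` alone by `1` forces `D u ≠ 0`, and then the
equation of `H` gives `∂_i H = 0`; moving `H` by `1` shows that `∂_i H ≠ 0`. -/
theorem IsGenericPair.axis (hg : IsGenericPair d₁ d₂ G H) (i : Fin n) (u : K)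
    (hG : eval (Pi.single i u) G = 0) : eval (Pi.single i u) H ≠ 0 := by
  intro hH
  have key : ∀ (D : Derivation ℂ K K) (p : MvPolynomial (Fin n) K),
      D (eval (Pi.single i u) p) = eval (Pi.single i u) (derivCoeffs D p) +
        eval (Pi.single i u) (pderiv i p) * D u := by
    intro D p
    rw [derivation_eval, Finset.sum_eq_single i (fun j _ hj => by simp [hj]) (by simp),
      Pi.single_eq_same]
  obtain ⟨D, hDG, hDH⟩ := hg 1 0 (by simp) (by simp)
  obtain ⟨D', -, hDH'⟩ := hg 0 1 (by simp) (by simp)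
  have h1 := key D G
  have h2 := key D H
  have h3 := key D' H
  rw [hG, hDG, map_zero, map_one] at h1
  rw [hH, hDH, map_zero, map_zero, zero_add] at h2
  rw [hH, hDH', map_zero, map_one] at h3
  rcases mul_eq_zero.1 h2.symm with h | h
  · simp [h] at h3
  · simp [h] at h1

end

/-! ### Polynomials with indeterminate coefficients and specialization to ℂ -/

instance finite_exponents (n d : ℕ) : Finite (Exponents n d) := by
  refine Finite.of_injective (β := Fin n → Fin (d + 1))
    (fun m i => ⟨m.1 i, Nat.lt_succ_of_le ((Finsupp.le_degree i m.1).trans m.2)⟩) fun m m' h => ?_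
  ext i
  exact congrArg Fin.val (congrFun h i)

instance fintype_exponents (n d : ℕ) : Fintype (Exponents n d) := Fintype.ofFinite _

/-- The polynomial with given coefficients. -/
def ofCoeffs {R : Type*} [CommSemiring R] {d : ℕ} (c : Exponents n d → R) :
    MvPolynomial (Fin n) R :=
  ∑ m, monomial m.1 (c m)

theorem coeff_ofCoeffs {R : Type*} [CommSemiring R] {d : ℕ} (c : Exponents n d → R)
    (m : Exponents n d) : coeff m.1 (ofCoeffs c) = c m := by
  classical
  simp [ofCoeffs, coeff_sum, coeff_monomial, Subtype.coe_inj]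

theorem coeff_ofCoeffs_of_lt {R : Type*} [CommSemiring R] {d : ℕ} (c : Exponents n d → R)
    {m : Fin n →₀ ℕ} (hm : d < m.degree) : coeff m (ofCoeffs c) = 0 := by
  classical
  rw [ofCoeffs, coeff_sum]
  refine Finset.sum_eq_zero fun k _ => ?_
  rw [coeff_monomial, if_neg]
  rintro rfl
  exact absurd k.2 (not_le.2 hm)

theorem coeff_eq_zero_of_degree_lt {R : Type*} [CommSemiring R] {p : MvPolynomial (Fin n) R}
    {m : Fin n →₀ ℕ} (hm : p.totalDegree < m.degree) : coeff m p = 0 :=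
  coeff_eq_zero_of_totalDegree_lt hm

theorem ofCoeffs_coeff {R : Type*} [CommSemiring R] {d : ℕ} {p : MvPolynomial (Fin n) R}
    (hp : p.totalDegree ≤ d) : ofCoeffs (fun m : Exponents n d => coeff m.1 p) = p := by
  ext m
  by_cases hm : m.degree ≤ d
  · exact coeff_ofCoeffs _ ⟨m, hm⟩
  · rw [coeff_ofCoeffs_of_lt _ (not_le.1 hm),
      coeff_eq_zero_of_degree_lt (hp.trans_lt (not_le.1 hm))]

theorem map_ofCoeffs {R S : Type*} [CommSemiring R] [CommSemiring S] (f : R →+* S) {d : ℕ}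
    (c : Exponents n d → R) : map f (ofCoeffs c) = ofCoeffs (fun m => f (c m)) := by
  simp [ofCoeffs, map_monomial]

theorem derivCoeffs_ofCoeffs {K : Type*} [Field K] [Algebra ℂ K] (D : Derivation ℂ K K) {d : ℕ}
    (c : Exponents n d → K) : derivCoeffs D (ofCoeffs c) = ofCoeffs (fun m => D (c m)) := by
  simp [ofCoeffs, derivCoeffs_monomial]

/-- The space of parameters: coefficients of numerators and denominators. -/
abbrev Params (n d₁ d₂ : ℕ) : Type := Exponents n d₁ ⊕ Exponents n d₂

/-- The numerator with indeterminate coefficients. -/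
def universalNum (n d₁ d₂ : ℕ) (v : Type) :
    MvPolynomial (Fin n) (MvPolynomial (Params n d₁ d₂ ⊕ v) ℂ) :=
  ofCoeffs fun m : Exponents n d₁ => X (.inl (.inl m))

/-- The denominator with indeterminate coefficients. -/
def universalDen (n d₁ d₂ : ℕ) (v : Type) :
    MvPolynomial (Fin n) (MvPolynomial (Params n d₁ d₂ ⊕ v) ℂ) :=
  ofCoeffs fun m : Exponents n d₂ => X (.inl (.inr m))

/-- A polynomial system in the coefficients of `G`, `H` and some unknowns, without solution over
fields where the coefficients are generic, is generically without solution over `ℂ`. -/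
theorem exists_eliminant_of_isGenericPair {d₁ d₂ : ℕ} {v : Type}
    (S : Set (MvPolynomial (Params n d₁ d₂ ⊕ v) ℂ))
    (h : ∀ (K : Type) [Field K] [Algebra ℂ K] (φ : MvPolynomial (Params n d₁ d₂ ⊕ v) ℂ →+* K),
      (∀ p ∈ S, φ p = 0) →
      ¬ IsGenericPair d₁ d₂ (map φ (universalNum n d₁ d₂ v)) (map φ (universalDen n d₁ d₂ v))) :
    ∃ Q : MvPolynomial (Params n d₁ d₂) ℂ, Q ≠ 0 ∧ ∀ G H : MvPolynomial (Fin n) ℂ,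
      G.totalDegree = d₁ → H.totalDegree = d₂ → eval (coeffVector d₁ d₂ G H) Q ≠ 0 →
      ∀ x : v → ℂ, ∃ φ : MvPolynomial (Params n d₁ d₂ ⊕ v) ℂ →+* ℂ,
        map φ (universalNum n d₁ d₂ v) = G ∧ map φ (universalDen n d₁ d₂ v) = H ∧
        (∀ i, φ (X (.inr i)) = x i) ∧ ∃ p ∈ S, φ p ≠ 0 := by
  -- Prescribing derivatives of the indeterminate coefficients is the same as prescribing
  -- `derivCoeffs D` on the two universal polynomials.
  obtain ⟨Q, hQ0, hQ⟩ := exists_eliminant S fun K _ _ φ hφ hD => by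
    refine h K φ.toRingHom hφ fun A B hA hB => ?_
    obtain ⟨D, hD⟩ := hD (Sum.elim (fun m => coeff m.1 A) (fun m => coeff m.1 B))
    refine ⟨D, ?_, ?_⟩
    · rw [universalNum, map_ofCoeffs, derivCoeffs_ofCoeffs]
      conv_rhs => rw [← ofCoeffs_coeff hA]
      exact congrArg _ (funext fun m => hD (.inl m))
    · rw [universalDen, map_ofCoeffs, derivCoeffs_ofCoeffs]
      conv_rhs => rw [← ofCoeffs_coeff hB]
      exact congrArg _ (funext fun m => hD (.inr m))
  refine ⟨Q, hQ0, fun G H hG hH hne x => ?_⟩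
  refine ⟨eval (Sum.elim (coeffVector d₁ d₂ G H) x), ?_, ?_, by simp, ?_⟩
  · rw [universalNum, map_ofCoeffs]
    simpa [coeffVector] using ofCoeffs_coeff hG.le
  · rw [universalDen, map_ofCoeffs]
    simpa [coeffVector] using ofCoeffs_coeff hH.le
  · by_contra! hcon
    refine hne ?_
    rw [← hQ (aeval (Sum.elim (coeffVector d₁ d₂ G H) x)) hcon]
    simp

section naturality

variable {R S : Type*} [CommRing R] [CommRing S] (φ : R →+* S)

theorem map_borderedJacobian (H : MvPolynomial (Fin n) R) (z : Fin n → R)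
    (r : Fin n ⊕ Fin 2 → R) :
    (borderedJacobian H z r).map φ =
      borderedJacobian (map φ H) (fun i => φ (z i)) (fun v => φ (r v)) := by
  ext e v
  rcases e with i | e
  · rcases v with j | v
    · simp [borderedJacobian, map_eval, ← pderiv_map, -Derivation.leibniz,
        Function.comp_def]
    · fin_cases v <;> simp [borderedJacobian]
  · fin_cases e
    · rcases v with j | v
      · simp [borderedJacobian, map_eval, ← pderiv_map, Function.comp_def]
      · fin_cases v <;> simp [borderedJacobian]
    · simp [borderedJacobian]

theorem map_scaledRow (H : MvPolynomial (Fin n) R) (z : Fin n → R) (t : R) :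
    (fun v => φ (scaledRow H z t v)) = scaledRow (map φ H) (fun i => φ (z i)) (φ t) := by
  ext v
  rcases v with j | v
  · simp [scaledRow, map_eval, ← pderiv_map, Function.comp_def]
  · fin_cases v <;> simp [scaledRow, map_eval, ← pderiv_map, Function.comp_def]

end naturality

/-! ### Eliminants for the bad coefficient vectors -/

/-- The equations in the unknowns `z`, `λ` saying that `z` is a critical point. -/
def criticalSystem {R : Type*} [CommRing R] (H : MvPolynomial (Fin n) R) (z : Fin n → R) (l : R) :
    Set R :=
  insert (eval z H) (Set.range fun i => z i * eval z (pderiv i H) - l)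

theorem forall_criticalSystem {R S : Type*} [CommRing R] [CommRing S] (φ : R →+* S)
    (H : MvPolynomial (Fin n) R) (z : Fin n → R) (l : R) :
    (∀ p ∈ criticalSystem H z l, φ p = 0) ↔ eval (fun i => φ (z i)) (map φ H) = 0 ∧
      ∀ i, φ (z i) * eval (fun i => φ (z i)) (pderiv i (map φ H)) = φ l := by
  simp [criticalSystem, map_eval, ← pderiv_map, Function.comp_def, sub_eq_zero]

/-- The vanishing of the Jacobian determinant is added to the equations as one more polynomial; the
enlarged system has no solution with generic coefficients. -/
theorem generic_extendedJacobian (hn : 1 ≤ n) (d₁ d₂ : ℕ) (hd₂ : 0 < d₂) :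
    ∃ Q : MvPolynomial (Params n d₁ d₂) ℂ, Q ≠ 0 ∧ ∀ G H : MvPolynomial (Fin n) ℂ,
      G.totalDegree = d₁ → H.totalDegree = d₂ → eval (coeffVector d₁ d₂ G H) Q ≠ 0 →
      ∀ (z : Fin n → ℂ) (l t : ℂ), eval z H = 0 → (∀ i, z i * eval z (pderiv i H) = l) →
        eval (fun i => t * z i) H = 0 → (borderedJacobian H z (scaledRow H z t)).det ≠ 0 := by
  let U := MvPolynomial (Params n d₁ d₂ ⊕ (Fin n ⊕ Fin 2)) ℂ
  let H' := universalDen n d₁ d₂ (Fin n ⊕ Fin 2)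
  let z' : Fin n → U := fun i => X (.inr (.inl i))
  let l' : U := X (.inr (.inr 0))
  let t' : U := X (.inr (.inr 1))
  have hS : ∀ {K : Type} [Field K] (φ : U →+* K),
      (∀ p ∈ insert (eval (fun i => t' * z' i) H')
        (insert (borderedJacobian H' z' (scaledRow H' z' t')).det (criticalSystem H' z' l')),
        φ p = 0) ↔ eval (fun i => φ t' * φ (z' i)) (map φ H') = 0 ∧
        (borderedJacobian (map φ H') (fun i => φ (z' i))
          (scaledRow (map φ H') (fun i => φ (z' i)) (φ t'))).det = 0 ∧
        eval (fun i => φ (z' i)) (map φ H') = 0 ∧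
        ∀ i, φ (z' i) * eval (fun i => φ (z' i)) (pderiv i (map φ H')) = φ l' := by
    intro K _ φ
    rw [← forall_criticalSystem, ← map_scaledRow, ← map_borderedJacobian, ← RingHom.mapMatrix_apply,
      ← RingHom.map_det, Set.forall_mem_insert, Set.forall_mem_insert, map_eval, Function.comp_def]
    simp only [map_mul]
    rfl
  obtain ⟨Q, hQ0, hQ⟩ := exists_eliminant_of_isGenericPair
    (insert (eval (fun i => t' * z' i) H')
        (insert (borderedJacobian H' z' (scaledRow H' z' t')).det (criticalSystem H' z' l')))
    fun K _ _ φ hφ hg => by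
      obtain ⟨h1, h2, h3, h4⟩ := (hS φ).1 hφ
      exact hg.det_scaledRow_ne_zero hn hd₂ h3 h4 h1 h2
  refine ⟨Q, hQ0, fun G H hG hH hne z l t h3 h4 h1 h2 => ?_⟩
  obtain ⟨φ, -, hφH, hφx, p, hp, hpne⟩ := hQ G H hG hH hne (Sum.elim z ![l, t])
  refine hpne ((hS φ).2 ?_ p hp)
  have e1 : ∀ i, φ (z' i) = z i := fun i => hφx (.inl i)
  have e2 : φ l' = l := hφx (.inr 0)
  have e3 : φ t' = t := hφx (.inr 1)
  have e4 : map φ H' = H := hφH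
  simp only [e1, e2, e3, e4]
  exact ⟨h1, h2, h3, h4⟩

theorem generic_numerator_ne_zero (d₁ d₂ : ℕ) (hd₂ : 0 < d₂) :
    ∃ Q : MvPolynomial (Params n d₁ d₂) ℂ, Q ≠ 0 ∧ ∀ G H : MvPolynomial (Fin n) ℂ,
      G.totalDegree = d₁ → H.totalDegree = d₂ → eval (coeffVector d₁ d₂ G H) Q ≠ 0 →
      ∀ (z : Fin n → ℂ) (l : ℂ), eval z H = 0 → (∀ i, z i * eval z (pderiv i H) = l) →
        eval z G ≠ 0 := by
  let U := MvPolynomial (Params n d₁ d₂ ⊕ (Fin n ⊕ Unit)) ℂ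
  let G' := universalNum n d₁ d₂ (Fin n ⊕ Unit)
  let H' := universalDen n d₁ d₂ (Fin n ⊕ Unit)
  let z' : Fin n → U := fun i => X (.inr (.inl i))
  let l' : U := X (.inr (.inr ()))
  have hS : ∀ {K : Type} [Field K] (φ : U →+* K),
      (∀ p ∈ insert (eval z' G') (criticalSystem H' z' l'), φ p = 0) ↔
        eval (fun i => φ (z' i)) (map φ G') = 0 ∧
        eval (fun i => φ (z' i)) (map φ H') = 0 ∧
        ∀ i, φ (z' i) * eval (fun i => φ (z' i)) (pderiv i (map φ H')) = φ l' := by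
    intro K _ φ
    rw [← forall_criticalSystem, Set.forall_mem_insert, map_eval]
    rfl
  obtain ⟨Q, hQ0, hQ⟩ := exists_eliminant_of_isGenericPair
    (insert (eval z' G') (criticalSystem H' z' l'))
    fun K _ _ φ hφ hg => by
      obtain ⟨h1, h2, h3⟩ := (hS φ).1 hφ
      exact hg.eval_ne_zero_of_critical hd₂ h2 h3 h1
  refine ⟨Q, hQ0, fun G H hG hH hne z l h2 h3 h1 => ?_⟩
  obtain ⟨φ, hφG, hφH, hφx, p, hp, hpne⟩ := hQ G H hG hH hne (Sum.elim z fun _ => l)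
  refine hpne ((hS φ).2 ?_ p hp)
  have e1 : ∀ i, φ (z' i) = z i := fun i => hφx (.inl i)
  have e2 : φ l' = l := hφx (.inr ())
  have e3 : map φ G' = G := hφG
  have e4 : map φ H' = H := hφH
  simp only [e1, e2, e3, e4]
  exact ⟨h1, h2, h3⟩

theorem generic_axis (d₁ d₂ : ℕ) (i : Fin n) :
    ∃ Q : MvPolynomial (Params n d₁ d₂) ℂ, Q ≠ 0 ∧ ∀ G H : MvPolynomial (Fin n) ℂ,
      G.totalDegree = d₁ → H.totalDegree = d₂ → eval (coeffVector d₁ d₂ G H) Q ≠ 0 →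
      ∀ u : ℂ, eval (Pi.single i u) H = 0 → eval (Pi.single i u) G ≠ 0 := by
  let U := MvPolynomial (Params n d₁ d₂ ⊕ Unit) ℂ
  let G' := universalNum n d₁ d₂ Unit
  let H' := universalDen n d₁ d₂ Unit
  let u' : U := X (.inr ())
  have hsingle : ∀ {K : Type} [Field K] (φ : U →+* K),
      φ ∘ (Pi.single i u' : Fin n → U) = Pi.single i (φ u') := by
    intro K _ φ
    ext j
    by_cases hj : j = i
    · subst hj; simp
    · simp [hj]
  have hS : ∀ {K : Type} [Field K] (φ : U →+* K),
      (∀ p ∈ ({eval (Pi.single i u') G', eval (Pi.single i u') H'} : Set U), φ p = 0) ↔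
        eval (Pi.single i (φ u')) (map φ G') = 0 ∧ eval (Pi.single i (φ u')) (map φ H') = 0 := by
    intro K _ φ
    simp [map_eval, hsingle]
  obtain ⟨Q, hQ0, hQ⟩ := exists_eliminant_of_isGenericPair
    {eval (Pi.single i u') G', eval (Pi.single i u') H'}
    fun K _ _ φ hφ hg => by
      obtain ⟨h1, h2⟩ := (hS φ).1 hφ
      exact hg.axis i _ h1 h2
  refine ⟨Q, hQ0, fun G H hG hH hne u h2 h1 => ?_⟩
  obtain ⟨φ, hφG, hφH, hφx, p, hp, hpne⟩ := hQ G H hG hH hne (fun _ => u)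
  refine hpne ((hS φ).2 ?_ p hp)
  have e2 : φ u' = u := hφx ()
  have e3 : map φ G' = G := hφG
  have e4 : map φ H' = H := hφH
  rw [e2, e3, e4]
  exact ⟨h1, h2⟩

/-- Generically, the denominator is not constant on the coordinate axes. -/
theorem generic_pure_power (d₁ d₂ : ℕ) (i : Fin n) :
    ∃ Q : MvPolynomial (Params n d₁ d₂) ℂ, Q ≠ 0 ∧ ∀ G H : MvPolynomial (Fin n) ℂ,
      eval (coeffVector d₁ d₂ G H) Q ≠ 0 → coeff (Finsupp.single i d₂) H ≠ 0 :=
  ⟨X (.inr ⟨Finsupp.single i d₂, by simp⟩), X_ne_zero _, fun G H h => by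
    simpa [coeffVector] using h⟩

theorem isProperAlgebraicSubset_zeroLocus {σ : Type} {Q : MvPolynomial σ ℂ} (hQ : Q ≠ 0) :
    IsProperAlgebraicSubset {x | eval x Q = 0} := by
  refine ⟨fun h => hQ (MvPolynomial.funext fun x => ?_), {Q}, by simp⟩
  rw [map_zero]
  exact Set.eq_univ_iff_forall.1 h x

/-! ### (J1) through the bordered Jacobian -/

/-- The chain rule for polynomial substitutions. -/
theorem pderiv_aeval {ι κ R : Type*} [Fintype ι] [CommRing R] (f : ι → MvPolynomial κ R)
    (p : MvPolynomial ι R) (v : κ) :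
    pderiv v (aeval f p) = ∑ j, aeval f (pderiv j p) * pderiv v (f j) := by
  classical
  induction p using MvPolynomial.induction_on with
  | C a => simp [algebraMap_eq]
  | add p q hp hq => simp only [map_add, hp, hq, add_mul, Finset.sum_add_distrib]
  | mul_X p i hp =>
    have : ∀ j, aeval f (Pi.single (M := fun _ => MvPolynomial ι R) j 1 i) =
        if i = j then 1 else 0 := by
      intro j
      rw [Pi.single_apply]
      split_ifs <;> simp
    simp only [map_mul, aeval_X, Derivation.leibniz, hp, smul_eq_mul, pderiv_X, map_add,
      add_mul, Finset.sum_add_distrib, this, mul_ite, mul_one, mul_zero, ite_mul, zero_mul,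
      Finset.sum_ite_eq, Finset.mem_univ, if_true, Finset.mul_sum, mul_assoc]

theorem eval_pderiv_inl_rename {R κ : Type*} [CommRing R] (x : Fin n ⊕ κ → R)
    (p : MvPolynomial (Fin n) R) (j : Fin n) :
    eval x (pderiv (Sum.inl j) (rename Sum.inl p)) = eval (fun i => x (.inl i)) (pderiv j p) := by
  rw [pderiv_rename Sum.inl_injective, eval_rename]
  rfl

theorem pderiv_inr_rename {R κ : Type*} [CommRing R] (p : MvPolynomial (Fin n) R) (v : κ) :
    pderiv (Sum.inr v : Fin n ⊕ κ) (rename Sum.inl p) = 0 := by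
  classical
  refine pderiv_eq_zero_of_notMem_vars fun h => ?_
  have := vars_rename Sum.inl p h
  simp at this

theorem eval_extendedSystem (H : MvPolynomial (Fin n) ℂ) (x : Fin n ⊕ Fin 2 → ℂ) :
    (∀ e, eval x (extendedSystem H e) = 0) ↔ eval (fun i => x (.inl i)) H = 0 ∧
      (∀ i, x (.inl i) * eval (fun i => x (.inl i)) (pderiv i H) = x (.inr 0)) ∧
      eval (fun i => x (.inr 1) * x (.inl i)) H = 0 := by
  have h : eval x (aeval (fun i => (X (Sum.inr 1) * X (Sum.inl i) :
          MvPolynomial (Fin n ⊕ Fin 2) ℂ)) H) = eval (fun i => x (.inr 1) * x (.inl i)) H := by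
    rw [← coe_aeval_eq_eval, ← coe_aeval_eq_eval, RingHom.coe_coe, RingHom.coe_coe,
      ← AlgHom.comp_apply, comp_aeval]
    simp
  simp only [Sum.forall, Fin.forall_fin_two, extendedSystem, h, map_sub, map_mul, eval_X,
    eval_rename, sub_eq_zero, Function.comp_def]
  tauto

theorem extendedJacobian_eq (H : MvPolynomial (Fin n) ℂ) (x : Fin n ⊕ Fin 2 → ℂ) :
    extendedJacobian H x = borderedJacobian H (fun i => x (.inl i))
      (scaledRow H (fun i => x (.inl i)) (x (.inr 1))) := by
  have h : ∀ p : MvPolynomial (Fin n) ℂ, eval x (aeval (fun i => (X (Sum.inr 1) * X (Sum.inl i) :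
          MvPolynomial (Fin n ⊕ Fin 2) ℂ)) p) = eval (fun i => x (.inr 1) * x (.inl i)) p := by
    intro p
    rw [← coe_aeval_eq_eval, ← coe_aeval_eq_eval, RingHom.coe_coe, RingHom.coe_coe,
      ← AlgHom.comp_apply, comp_aeval]
    simp
  ext e v
  rcases e with i | e
  · rcases v with j | v
    · simp only [extendedJacobian, extendedSystem, borderedJacobian, Matrix.of_apply, Sum.elim_inl,
        map_sub]
      rw [pderiv_X_of_ne (by simp), map_zero, sub_zero, ← eval_pderiv_inl_rename,
        map_mul (rename Sum.inl), rename_X]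
    · fin_cases v
      · simp [extendedJacobian, extendedSystem, borderedJacobian, pderiv_inr_rename, pderiv_X]
      · simp [extendedJacobian, extendedSystem, borderedJacobian, pderiv_inr_rename, pderiv_X]
  · fin_cases e
    · rcases v with j | v
      · simp [extendedJacobian, extendedSystem, borderedJacobian, eval_pderiv_inl_rename]
      · fin_cases v <;>
          simp [extendedJacobian, extendedSystem, borderedJacobian, pderiv_inr_rename]
    · rcases v with j | v
      · simp only [extendedJacobian, extendedSystem, borderedJacobian, Matrix.of_apply,
          scaledRow, Sum.elim_inl, pderiv_aeval, map_sum, map_mul, h, Fin.mk_one]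
        rw [Finset.sum_eq_single j]
        · simp [pderiv_X, mul_comm]
        · intro k _ hk
          simp [pderiv_X, hk]
        · simp
      · simp only [extendedJacobian, extendedSystem, borderedJacobian, Matrix.of_apply,
          scaledRow, Sum.elim_inr, pderiv_aeval, map_sum, map_mul, h, Fin.mk_one]
        fin_cases v <;> simp [pderiv_X, mul_comm]

theorem J1_iff (H : MvPolynomial (Fin n) ℂ) :
    J1 H ↔ ∀ (z : Fin n → ℂ) (l t : ℂ), eval z H = 0 →
      (∀ i, z i * eval z (pderiv i H) = l) → eval (fun i => t * z i) H = 0 →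
      (borderedJacobian H z (scaledRow H z t)).det ≠ 0 := by
  constructor
  · intro hJ z l t h1 h2 h3
    have := hJ (Sum.elim z ![l, t]) ((eval_extendedSystem H _).2 ⟨h1, h2, h3⟩)
    rwa [extendedJacobian_eq] at this
  · intro h x hx
    obtain ⟨h1, h2, h3⟩ := (eval_extendedSystem H x).1 hx
    rw [extendedJacobian_eq]
    exact h _ _ _ h1 h2 h3

/-- Consequences of (J1) at the solutions with `t = 1`. -/
theorem J1.critical {H : MvPolynomial (Fin n) ℂ} (hJ : J1 H) {z : Fin n → ℂ} {l : ℂ}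
    (hH : eval z H = 0) (hz : ∀ i, z i * eval z (pderiv i H) = l) :
    l ≠ 0 ∧ ∀ (U : Fin n → ℂ) (s : ℂ), ∑ j, eval z (pderiv j H) * U j = 0 →
      (∀ i, ∑ j, eval z (pderiv j (X i * pderiv i H)) * U j = s) → U = 0 := by
  have hdet := (J1_iff H).1 hJ z l 1 hH hz (by simpa using hH)
  constructor
  · rintro rfl
    -- The only entry of the column of `t` that can be nonzero is `∑ j, z j * ∂_j H`, equal to `n l`
    -- at `t = 1`.
    refine hdet (Matrix.det_eq_zero_of_column_eq_zero (.inr 1) fun v => ?_)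
    rcases v with i | v
    · simp [borderedJacobian]
    · fin_cases v <;> simp [borderedJacobian, scaledRow, hz]
  · intro U s h1 h2
    by_contra hU
    -- The variation of `λ` is `s` and that of `t` is `0`. At `t = 1` the last row agrees with the
    -- row of `H` in the variables `z`, so it imposes nothing new.
    refine hdet (Matrix.exists_mulVec_eq_zero_iff.1 ⟨Sum.elim U ![s, 0], ?_, ?_⟩)
    · exact fun h => hU (funext fun i => congrFun h (.inl i))
    · ext e
      rcases e with i | e
      · have := h2 i
        simp [Matrix.mulVec, dotProduct, borderedJacobian, Fintype.sum_sum_type,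
          -Derivation.leibniz, this]
      · fin_cases e
        · simpa [Matrix.mulVec, dotProduct, borderedJacobian, Fintype.sum_sum_type] using h1
        · simpa [Matrix.mulVec, dotProduct, borderedJacobian, scaledRow, Fintype.sum_sum_type]
            using h1

/-! ### Implicit functions and the Hessian of `ψ` -/

theorem hasFDerivAt_eval {ι : Type*} [Fintype ι] (p : MvPolynomial ι ℂ) (z : ι → ℂ) :
    HasFDerivAt (fun z => eval z p)
      (∑ j, eval z (pderiv j p) • (ContinuousLinearMap.proj j : (ι → ℂ) →L[ℂ] ℂ)) z := by
  classical
  induction p using MvPolynomial.induction_on with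
  | C a =>
    simp only [eval_C]
    exact (hasFDerivAt_const (𝕜 := ℂ) a z).congr_fderiv (ContinuousLinearMap.ext fun u => by simp)
  | add p q hp hq =>
    simp only [map_add]
    refine (hp.fun_add hq).congr_fderiv (ContinuousLinearMap.ext fun u => ?_)
    simp [add_mul, Finset.sum_add_distrib]
  | mul_X p i hp =>
    simp only [map_mul, eval_X]
    refine (hp.fun_mul (hasFDerivAt_apply i z)).congr_fderiv
      (ContinuousLinearMap.ext fun u => ?_)
    have : ∀ j, eval z (Pi.single (M := fun _ => MvPolynomial ι ℂ) j 1 i) =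
        if i = j then 1 else 0 := by
      intro j
      rw [Pi.single_apply]
      split_ifs <;> simp
    simp [this, pderiv_X, add_mul, Finset.sum_add_distrib, Finset.mul_sum, mul_assoc]

/-- The derivative of the parametrization `y ↦ insertCoord k y (g y)` of a graph. -/
def insertCoordDeriv (k : Fin n) (g' : ({j : Fin n // j ≠ k} → ℂ) →L[ℂ] ℂ) :
    ({j : Fin n // j ≠ k} → ℂ) →L[ℂ] (Fin n → ℂ) :=
  ContinuousLinearMap.pi fun j => if h : j = k then g' else ContinuousLinearMap.proj ⟨j, h⟩

theorem insertCoordDeriv_apply (k : Fin n) (g' : ({j : Fin n // j ≠ k} → ℂ) →L[ℂ] ℂ)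
    (u : {j : Fin n // j ≠ k} → ℂ) : insertCoordDeriv k g' u = insertCoord k u (g' u) := by
  ext j
  by_cases h : j = k <;> simp [insertCoordDeriv, insertCoord, h]

theorem hasFDerivAt_insertCoord (k : Fin n) {g : ({j : Fin n // j ≠ k} → ℂ) → ℂ}
    {g' : ({j : Fin n // j ≠ k} → ℂ) →L[ℂ] ℂ} {y : {j : Fin n // j ≠ k} → ℂ}
    (hg : HasFDerivAt g g' y) :
    HasFDerivAt (fun y => insertCoord k y (g y)) (insertCoordDeriv k g') y := by
  refine hasFDerivAt_pi.2 fun j => ?_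
  by_cases h : j = k
  · simpa [insertCoord, h] using hg
  · simpa [insertCoord, h] using hasFDerivAt_apply (𝕜 := ℂ) (⟨j, h⟩ : {j : Fin n // j ≠ k}) y

theorem hasFDerivAt_eval_insertCoord (k : Fin n) {g : ({j : Fin n // j ≠ k} → ℂ) → ℂ}
    {g' : ({j : Fin n // j ≠ k} → ℂ) →L[ℂ] ℂ} {y : {j : Fin n // j ≠ k} → ℂ}
    (hg : HasFDerivAt g g' y) (p : MvPolynomial (Fin n) ℂ) :
    HasFDerivAt (fun y => eval (insertCoord k y (g y)) p)
      ((∑ j, eval (insertCoord k y (g y)) (pderiv j p) •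
        (ContinuousLinearMap.proj j : (Fin n → ℂ) →L[ℂ] ℂ)).comp (insertCoordDeriv k g')) y :=
  (hasFDerivAt_eval p _).comp y (hasFDerivAt_insertCoord k hg)

theorem insertCoord_removeCoord (k : Fin n) (z : Fin n → ℂ) :
    insertCoord k (removeCoord k z) (z k) = z := by
  ext j
  by_cases h : j = k
  · subst h; simp [insertCoord]
  · simp [insertCoord, removeCoord, h]

theorem sum_mul_insertCoord_single (k : Fin n) (i : {j : Fin n // j ≠ k}) (a : Fin n → ℂ) (s : ℂ) :
    ∑ j, a j * insertCoord k (Pi.single i 1) s j = a i + a k * s := by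
  have : ∀ j, a j * insertCoord k (Pi.single i 1) s j =
      (if j = i then a j else 0) + if j = k then a j * s else 0 := by
    intro j
    by_cases h : j = k
    · subst h
      simp [insertCoord, i.2.symm]
    · by_cases h' : j = i
      · subst h'
        simp [insertCoord, h]
      · have : (⟨j, h⟩ : {j : Fin n // j ≠ k}) ≠ i := fun e => h' (congrArg Subtype.val e)
        simp [insertCoord, h, h', this]
  simp [this, Finset.sum_add_distrib]

/-- The analytic implicit function theorem for a polynomial. -/
theorem exists_implicit (H : MvPolynomial (Fin n) ℂ) {z : Fin n → ℂ} (hH : eval z H = 0)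
    {k : Fin n} (hk : eval z (pderiv k H) ≠ 0) :
    ∃ g : ({j : Fin n // j ≠ k} → ℂ) → ℂ, AnalyticAt ℂ g (removeCoord k z) ∧
      g (removeCoord k z) = z k ∧
      ∀ᶠ y in 𝓝 (removeCoord k z), eval (insertCoord k y (g y)) H = 0 := by
  let E := {j : Fin n // j ≠ k} → ℂ
  let ins : E × ℂ →L[ℂ] (Fin n → ℂ) := ContinuousLinearMap.pi fun j =>
    if h : j = k then ContinuousLinearMap.snd ℂ E ℂ
    else (ContinuousLinearMap.proj ⟨j, h⟩).comp (ContinuousLinearMap.fst ℂ E ℂ)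
  have hins : ∀ q : E × ℂ, ins q = insertCoord k q.1 q.2 := by
    intro q
    ext j
    by_cases h : j = k <;> simp [ins, insertCoord, h]
  let u : E × ℂ := (removeCoord k z, z k)
  have hu : ins u = z := by rw [hins]; exact insertCoord_removeCoord k z
  let f : E × ℂ → ℂ := fun q => eval (ins q) H
  have hf : ContDiffAt ℂ ω f u :=
    (AnalyticOnNhd.eval_continuousLinearMap ins H u trivial).contDiffAt
  have hfd : HasFDerivAt f ((∑ j, eval z (pderiv j H) •
      (ContinuousLinearMap.proj j : (Fin n → ℂ) →L[ℂ] ℂ)).comp ins) u := by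
    have := hasFDerivAt_eval H (ins u)
    rw [hu] at this
    rw [← hu] at this
    have h2 := this.comp u ins.hasFDerivAt
    rw [hu] at h2
    exact h2
  have hinv : (fderiv ℂ f u ∘L .inr ℂ E ℂ).IsInvertible := by
    refine ⟨ContinuousLinearEquiv.smulLeft (Units.mk0 _ hk), ?_⟩
    ext
    rw [hfd.fderiv]
    have : ∀ j, ins (0, 1) j = if j = k then 1 else 0 := by
      intro j
      have h0 : ∀ i, (0 : E) i = 0 := fun _ => rfl
      rw [hins]
      by_cases h : j = k <;> simp [insertCoord, h, h0]
    simp [this, Units.smul_def]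
  refine ⟨hf.implicitFunction (by simp) hinv, ?_, ?_, ?_⟩
  · exact (hf.contDiffAt_implicitFunction (by simp) hinv).analyticAt
  · exact hf.implicitFunction_apply_self (by simp) hinv
  · filter_upwards [hf.eventually_apply_implicitFunction (by simp) hinv] with y hy
    have h0 : f u = 0 := by simp only [f, hu, hH]
    rw [h0] at hy
    have hy' : eval (ins (y, _)) H = 0 := hy
    rwa [hins] at hy'

/-- The partial derivatives of `ψ` in terms of those of `H`. -/
theorem fderiv_prod_mul_implicit (H : MvPolynomial (Fin n) ℂ) (k : Fin n)
    {g : ({j : Fin n // j ≠ k} → ℂ) → ℂ} {y : {j : Fin n // j ≠ k} → ℂ}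
    (hg : DifferentiableAt ℂ g y) (hgH : ∀ᶠ y in 𝓝 y, eval (insertCoord k y (g y)) H = 0)
    (i : {j : Fin n // j ≠ k}) :
    y i * fderiv ℂ (fun y => (∏ j, y j) * g y) y (Pi.single i 1) *
        eval (insertCoord k y (g y)) (pderiv k H) =
      (∏ j, y j) * eval (insertCoord k y (g y)) (X k * pderiv k H - X i.1 * pderiv i.1 H) := by
  -- Implicit differentiation: `∂_i H + ∂_k H * ∂_i g = 0` along the graph.
  have h1 : eval (insertCoord k y (g y)) (pderiv i.1 H) +
      eval (insertCoord k y (g y)) (pderiv k H) * fderiv ℂ g y (Pi.single i 1) = 0 := by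
    have h := (hasFDerivAt_eval_insertCoord k hg.hasFDerivAt H).unique
      ((hasFDerivAt_const (0 : ℂ) y).congr_of_eventuallyEq hgH)
    have h' := DFunLike.congr_fun h (Pi.single i 1)
    simp only [ContinuousLinearMap.comp_apply, insertCoordDeriv_apply,
      _root_.sum_apply, _root_.smul_apply, ContinuousLinearMap.proj_apply,
      smul_eq_mul, _root_.zero_apply] at h'
    rwa [sum_mul_insertCoord_single] at h'
  have h2 := (hasFDerivAt_finsetProd (𝕜 := ℂ) (u := Finset.univ) (x := y)).fun_mul hg.hasFDerivAt
  rw [h2.fderiv]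
  have h3 : y i * ∏ j ∈ Finset.univ.erase i, y j = ∏ j, y j :=
    Finset.mul_prod_erase _ _ (Finset.mem_univ i)
  have h4 : insertCoord k y (g y) k = g y := by simp [insertCoord]
  have h5 : insertCoord k y (g y) i.1 = y i := by simp [insertCoord, i.2]
  simp only [_root_.add_apply, _root_.smul_apply,
    _root_.sum_apply, ContinuousLinearMap.proj_apply, smul_eq_mul, Pi.single_apply,
    mul_ite, mul_one, mul_zero, Finset.sum_ite_eq', Finset.mem_univ, if_true,
    map_sub, map_mul, eval_X, h4, h5]
  rw [← h3]
  linear_combination (y i) ^ 2 * (∏ j ∈ Finset.univ.erase i, y j) * h1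

/-- Up to nonvanishing factors, `∂_i ψ` is `z_k ∂_k H - z_i ∂_i H` along the graph, and both vanish
at `z`. A null vector of the Hessian therefore lifts to a tangent vector of the graph along which
all `z_i ∂_i H` vary at the same rate, which `hker` excludes. -/
theorem isNondegenerate_of_jacobian (hn : 1 ≤ n) {H : MvPolynomial (Fin n) ℂ} {z : Fin n → ℂ}
    {l : ℂ} (hH : eval z H = 0) (hz : ∀ i, z i * eval z (pderiv i H) = l) (hl : l ≠ 0)
    (hker : ∀ (U : Fin n → ℂ) (s : ℂ), ∑ j, eval z (pderiv j H) * U j = 0 →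
      (∀ i, ∑ j, eval z (pderiv j (X i * pderiv i H)) * U j = s) → U = 0) :
    IsNondegenerate H z := by
  have hzi : ∀ i, z i ≠ 0 := fun i h => hl (by rw [← hz i, h, zero_mul])
  have hdi : ∀ i, eval z (pderiv i H) ≠ 0 := fun i h => hl (by rw [← hz i, h, mul_zero])
  refine ⟨⟨⟨0, hn⟩, hdi _⟩, fun k hk => ?_⟩
  obtain ⟨g, hga, hgz, hgH⟩ := exists_implicit H hH hk
  refine ⟨g, hga, hgz, hgH, fun hdet => ?_⟩
  obtain ⟨u, hu0, hu⟩ := Matrix.exists_vecMul_eq_zero_iff.2 hdet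
  set y₀ := removeCoord k z with hy₀
  set ψ : ({j : Fin n // j ≠ k} → ℂ) → ℂ := fun y => (∏ j, y j) * g y with hψ
  have hψa : AnalyticAt ℂ ψ y₀ :=
    (Finset.univ.analyticAt_fun_prod fun j _ =>
      (ContinuousLinearMap.proj (R := ℂ) (φ := fun _ : {j : Fin n // j ≠ k} => ℂ) j).analyticAt
        y₀).mul hga
  have hZ : insertCoord k y₀ (g y₀) = z := by rw [hgz]; exact insertCoord_removeCoord k z
  have hprod : ∏ j, y₀ j ≠ 0 := Finset.prod_ne_zero_iff.2 fun j _ => hzi j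
  have hψd : ∀ i : {j : Fin n // j ≠ k}, DifferentiableAt ℂ
      (fun x => fderiv ℂ ψ x (Pi.single i 1)) y₀ := fun i =>
    hψa.fderiv.differentiableAt.clm_apply (differentiableAt_const _)
  have hhess : ∀ i, fderiv ℂ (fun x => fderiv ℂ ψ x (Pi.single i 1)) y₀ u = 0 := by
    intro i
    have h := congrFun hu i
    simp only [Matrix.vecMul, dotProduct, hessian, Matrix.of_apply, Pi.zero_apply] at h
    rw [← h]
    conv_lhs => rw [pi_eq_sum_univ' u, map_sum]
    refine Finset.sum_congr rfl fun j _ => ?_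
    rw [map_smul, smul_eq_mul]
  have hgd := hga.differentiableAt.hasFDerivAt
  -- The tangent vector of the graph above `u`.
  set U := insertCoord k u (fderiv ℂ g y₀ u) with hU
  have hderiv : ∀ p : MvPolynomial (Fin n) ℂ,
      ∃ p' : ({j : Fin n // j ≠ k} → ℂ) →L[ℂ] ℂ,
        HasFDerivAt (fun y => eval (insertCoord k y (g y)) p) p' y₀ ∧
        p' u = ∑ j, eval z (pderiv j p) * U j := by
    intro p
    refine ⟨_, hasFDerivAt_eval_insertCoord k hgd p, ?_⟩
    simp [insertCoordDeriv_apply, hZ, hU]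
  have hrel : ∀ i : {j : Fin n // j ≠ k},
      ∑ j, eval z (pderiv j (X k * pderiv k H - X i.1 * pderiv i.1 H)) * U j = 0 := by
    intro i
    -- The identity holds on a neighbourhood, so it may be differentiated along `u`. On the left
    -- both `∂_i ψ` and its derivative along `u` vanish at `y₀`; on the right only the derivative of
    -- the second factor survives.
    have hev : (fun y : {j : Fin n // j ≠ k} → ℂ => y i * fderiv ℂ ψ y (Pi.single i 1) *
        eval (insertCoord k y (g y)) (pderiv k H)) =ᶠ[𝓝 y₀]
        fun y => (∏ j, y j) *
          eval (insertCoord k y (g y)) (X k * pderiv k H - X i.1 * pderiv i.1 H) := by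
      filter_upwards [hga.eventually_analyticAt, eventually_eventually_nhds.2 hgH] with y h1 h2
      exact fderiv_prod_mul_implicit H k h1.differentiableAt h2 i
    have hμ : eval z (X k * pderiv k H - X i.1 * pderiv i.1 H) = 0 := by
      simp [hz]
    have h0 : fderiv ℂ ψ y₀ (Pi.single i 1) = 0 := by
      have h := hev.eq_of_nhds
      simp only [hZ, hμ, mul_zero] at h
      exact (mul_eq_zero.1 ((mul_eq_zero.1 h).resolve_right hk)).resolve_left (hzi i)
    obtain ⟨a', ha', -⟩ := hderiv (pderiv k H)
    obtain ⟨m', hm', hmu⟩ := hderiv (X k * pderiv k H - X i.1 * pderiv i.1 H)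
    have hL := ((hasFDerivAt_apply (𝕜 := ℂ) i y₀).fun_mul (hψd i).hasFDerivAt).fun_mul ha'
    have hR := (hasFDerivAt_finsetProd (𝕜 := ℂ) (u := Finset.univ) (x := y₀)).fun_mul hm'
    have h := DFunLike.congr_fun (hL.unique (hR.congr_of_eventuallyEq hev)) u
    simp only [_root_.add_apply, _root_.smul_apply, smul_eq_mul,
      hhess i, h0, hZ, hμ, hmu, mul_zero, zero_mul, add_zero] at h
    exact (mul_eq_zero.1 h.symm).resolve_left hprod
  have hU0 : U = 0 := by
    refine hker U (∑ j, eval z (pderiv j (X k * pderiv k H)) * U j) ?_ fun i => ?_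
    · obtain ⟨p', hp', hpu⟩ := hderiv H
      rw [← hpu, hp'.unique ((hasFDerivAt_const (0 : ℂ) y₀).congr_of_eventuallyEq hgH)]
      rfl
    · by_cases hi : i = k
      · rw [hi]
      · have h := hrel ⟨i, hi⟩
        rw [← sub_eq_zero, ← neg_eq_zero, neg_sub, ← Finset.sum_sub_distrib, ← h]
        exact Finset.sum_congr rfl fun j _ => by rw [map_sub, map_sub, sub_mul]
  refine hu0 (funext fun j => ?_)
  have := congrFun hU0 j.1
  simpa [hU, insertCoord, j.2] using this

/-! ### Absolute convergence and the domain of convergence -/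

/-- Absolute convergence of a power series at a point. -/
def AbsConvAt (f : MvPowerSeries (Fin n) ℂ) (z : Fin n → ℂ) : Prop :=
  Summable fun m : Fin n →₀ ℕ => ‖MvPowerSeries.coeff m f‖ * ∏ i, ‖z i‖ ^ m i

theorem AbsConvAt.mono {f : MvPowerSeries (Fin n) ℂ} {z w : Fin n → ℂ} (h : AbsConvAt f z)
    (hw : ∀ i, ‖w i‖ ≤ ‖z i‖) : AbsConvAt f w :=
  Summable.of_nonneg_of_le (fun m => by positivity) (fun m => by gcongr; exact hw _) h

theorem norm_coeff_mul_prod (f : MvPowerSeries (Fin n) ℂ) (z : Fin n → ℂ) (m : Fin n →₀ ℕ) :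
    ‖MvPowerSeries.coeff m f * ∏ i, z i ^ m i‖ =
      ‖MvPowerSeries.coeff m f‖ * ∏ i, ‖z i‖ ^ m i := by
  rw [norm_mul, norm_prod]
  simp_rw [norm_pow]

theorem AbsConvAt.summable {f : MvPowerSeries (Fin n) ℂ} {z : Fin n → ℂ} (h : AbsConvAt f z) :
    Summable fun m : Fin n →₀ ℕ => MvPowerSeries.coeff m f * ∏ i, z i ^ m i :=
  Summable.of_norm (by
    simp only [norm_coeff_mul_prod]
    exact h)

/-- The sum of a power series. -/
def sumAt (f : MvPowerSeries (Fin n) ℂ) (z : Fin n → ℂ) : ℂ :=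
  ∑' m : Fin n →₀ ℕ, MvPowerSeries.coeff m f * ∏ i, z i ^ m i

theorem AbsConvAt.mul_X {f : MvPowerSeries (Fin n) ℂ} {z : Fin n → ℂ} (h : AbsConvAt f z)
    (i : Fin n) : AbsConvAt (f * MvPowerSeries.X i) z ∧
      sumAt (f * MvPowerSeries.X i) z = sumAt f z * z i := by
  classical
  have hinj : Function.Injective fun m : Fin n →₀ ℕ => m + Finsupp.single i 1 :=
    add_left_injective _
  have hcoeff : ∀ m, MvPowerSeries.coeff (m + Finsupp.single i 1) (f * MvPowerSeries.X i) =
      MvPowerSeries.coeff m f := by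
    intro m
    rw [MvPowerSeries.X, MvPowerSeries.coeff_add_mul_monomial, mul_one]
  have hzero : ∀ m, m ∉ Set.range (fun m : Fin n →₀ ℕ => m + Finsupp.single i 1) →
      MvPowerSeries.coeff m (f * MvPowerSeries.X i) = 0 := by
    intro m hm
    rw [MvPowerSeries.X, MvPowerSeries.coeff_mul_monomial, if_neg]
    exact fun hle => hm ⟨m - Finsupp.single i 1, tsub_add_cancel_of_le hle⟩
  have hprod : ∀ {M : Type} [CommMonoid M] (y : Fin n → M) (m : Fin n →₀ ℕ),
      ∏ j, y j ^ ((m + Finsupp.single i 1 : Fin n →₀ ℕ) j) = (∏ j, y j ^ m j) * y i := by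
    intro M _ y m
    simp only [Finsupp.add_apply, pow_add, Finset.prod_mul_distrib]
    congr 1
    rw [Finset.prod_eq_single i]
    · simp
    · intro j _ hj
      simp [hj.symm]
    · simp
  constructor
  · refine (hinj.summable_iff fun m hm => by simp [hzero m hm]).1 ?_
    refine (h.mul_right ‖z i‖).congr fun m => ?_
    simp only [Function.comp_apply, hcoeff, hprod (fun j => ‖z j‖), mul_assoc]
  · rw [sumAt, sumAt, ← tsum_mul_right, ← hinj.tsum_eq]
    · simp only [hcoeff, hprod z, mul_assoc]
    · intro m hm
      by_contra hm'
      exact hm (by simp [hzero m hm'])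

theorem AbsConvAt.mul_coe {f : MvPowerSeries (Fin n) ℂ} {z : Fin n → ℂ} (h : AbsConvAt f z)
    (p : MvPolynomial (Fin n) ℂ) : AbsConvAt (f * (p : MvPowerSeries (Fin n) ℂ)) z ∧
      sumAt (f * (p : MvPowerSeries (Fin n) ℂ)) z = sumAt f z * eval z p := by
  induction p using MvPolynomial.induction_on with
  | C a =>
    have hc : ∀ m, MvPowerSeries.coeff m (f * MvPowerSeries.C a) = MvPowerSeries.coeff m f * a :=
      fun m => MvPowerSeries.coeff_mul_C m f a
    rw [coe_C]
    constructor
    · refine (h.mul_right ‖a‖).congr fun m => ?_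
      rw [hc, norm_mul]
      ring
    · rw [sumAt, sumAt, eval_C, ← tsum_mul_right]
      exact tsum_congr fun m => by rw [hc]; ring
  | add p q hp hq =>
    rw [coe_add, mul_add]
    constructor
    · refine Summable.of_nonneg_of_le (fun m => by positivity) (fun m => ?_) (hp.1.add hq.1)
      rw [map_add, ← add_mul]
      gcongr
      exact norm_add_le _ _
    · rw [map_add, mul_add, ← hp.2, ← hq.2, sumAt, sumAt, sumAt,
        ← hp.1.summable.tsum_add hq.1.summable]
      exact tsum_congr fun m => by rw [map_add, add_mul]
  | mul_X p i hp =>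
    rw [coe_mul, coe_X, ← mul_assoc]
    refine ⟨(hp.1.mul_X i).1, ?_⟩
    rw [(hp.1.mul_X i).2, hp.2, map_mul, eval_X, mul_assoc]

theorem absConvAt_coe (p : MvPolynomial (Fin n) ℂ) (z : Fin n → ℂ) :
    AbsConvAt (p : MvPowerSeries (Fin n) ℂ) z ∧
      sumAt (p : MvPowerSeries (Fin n) ℂ) z = eval z p := by
  classical
  have h0 : ∀ m : Fin n →₀ ℕ, m ≠ 0 → MvPowerSeries.coeff m (1 : MvPowerSeries (Fin n) ℂ) = 0 :=
    fun m hm => by rw [MvPowerSeries.coeff_one, if_neg hm]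
  have h1 : AbsConvAt (1 : MvPowerSeries (Fin n) ℂ) z :=
    summable_of_ne_finset_zero (s := {0}) fun m hm => by
      rw [h0 m (by simpa using hm), norm_zero, zero_mul]
  have h2 : sumAt (1 : MvPowerSeries (Fin n) ℂ) z = 1 := by
    rw [sumAt, tsum_eq_single 0 fun m hm => by rw [h0 m hm, zero_mul]]
    simp
  have := h1.mul_coe p
  rwa [one_mul, h2, one_mul] at this

theorem constantCoeff_coe_ne_zero {H : MvPolynomial (Fin n) ℂ} (hH : eval 0 H ≠ 0) :
    MvPowerSeries.constantCoeff (H : MvPowerSeries (Fin n) ℂ) ≠ 0 := by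
  rw [← MvPowerSeries.coeff_zero_eq_constantCoeff_apply, coeff_coe]
  rwa [eval_zero, constantCoeff_eq] at hH

theorem taylorSeries_mul (G : MvPolynomial (Fin n) ℂ) {H : MvPolynomial (Fin n) ℂ}
    (hH : eval 0 H ≠ 0) :
    taylorSeries G H * (H : MvPowerSeries (Fin n) ℂ) = (G : MvPowerSeries (Fin n) ℂ) := by
  rw [taylorSeries, mul_assoc, MvPowerSeries.inv_mul_cancel _ (constantCoeff_coe_ne_zero hH),
    mul_one]

/-- The sum of the expansion of `G / H`. -/
theorem sumAt_taylorSeries {G H : MvPolynomial (Fin n) ℂ} (hH : eval 0 H ≠ 0) {z : Fin n → ℂ}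
    (h : AbsConvAt (taylorSeries G H) z) :
    sumAt (taylorSeries G H) z * eval z H = eval z G := by
  rw [← (h.mul_coe H).2, taylorSeries_mul G hH, (absConvAt_coe G z).2]

/-- The relation `f * H = 1` bounds each coefficient of `f` by earlier ones. For small `r` the
nonconstant part of `H` weighs at most half of its constant term, so the weighted partial sums
absorb their own contribution. -/
theorem exists_absConvAt_inv {H : MvPolynomial (Fin n) ℂ} (hH : eval 0 H ≠ 0) :
    ∃ r : ℝ, 0 < r ∧ AbsConvAt (H : MvPowerSeries (Fin n) ℂ)⁻¹ fun _ => (r : ℂ) := by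
  classical
  set f : MvPowerSeries (Fin n) ℂ := (H : MvPowerSeries (Fin n) ℂ)⁻¹ with hf
  set c := ‖MvPowerSeries.constantCoeff (H : MvPowerSeries (Fin n) ℂ)‖ with hc
  have hc0 : 0 < c := norm_pos_iff.2 (constantCoeff_coe_ne_zero hH)
  set S := ∑ k ∈ H.support, ‖coeff k H‖ with hS
  have hS0 : 0 ≤ S := by positivity
  -- The bound `r ≤ 1` gives `r ^ k.degree ≤ r` for `k ≠ 0`, and `S + 1` keeps the denominator
  -- positive.
  set r := min 1 (c / (2 * (S + 1))) with hr
  have hr0 : 0 < r := lt_min one_pos (by positivity)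
  have hr1 : r ≤ 1 := min_le_left _ _
  refine ⟨r, hr0, ?_⟩
  have hpow : ∀ m : Fin n →₀ ℕ, ∏ i, ‖(r : ℂ)‖ ^ m i = r ^ m.degree := by
    intro m
    rw [Finset.prod_pow_eq_pow_sum, Complex.norm_real, Real.norm_of_nonneg hr0.le,
      Finsupp.degree_eq_sum]
  simp only [AbsConvAt, hpow]
  have hsmall : ∑ k ∈ H.support.erase 0, ‖coeff k H‖ * r ^ k.degree ≤ c / 2 := by
    calc ∑ k ∈ H.support.erase 0, ‖coeff k H‖ * r ^ k.degree
        ≤ ∑ k ∈ H.support.erase 0, ‖coeff k H‖ * r := by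
          refine Finset.sum_le_sum fun k hk => ?_
          gcongr
          refine pow_le_of_le_one hr0.le hr1 ?_
          rw [Ne, Finsupp.degree_eq_zero_iff]
          exact Finset.ne_of_mem_erase hk
      _ ≤ S * r := by
          rw [← Finset.sum_mul]
          gcongr
          exact Finset.sum_le_sum_of_subset_of_nonneg (Finset.erase_subset _ _)
            fun _ _ _ => norm_nonneg _
      _ ≤ S * (c / (2 * (S + 1))) := by gcongr; exact min_le_right _ _
      _ ≤ c / 2 := by
          rw [mul_div_assoc', div_le_div_iff₀ (by positivity) two_pos]
          nlinarith
  have hmul : f * (H : MvPowerSeries (Fin n) ℂ) = 1 :=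
    MvPowerSeries.inv_mul_cancel _ (constantCoeff_coe_ne_zero hH)
  -- the recursion for the coefficients of the inverse
  have hrec : ∀ m : Fin n →₀ ℕ, c * (‖MvPowerSeries.coeff m f‖ * r ^ m.degree) ≤
      (if m = 0 then 1 else 0) + ∑ p ∈ (Finset.HasAntidiagonal.antidiagonal m).filter (fun p => p.2 ≠ 0),
        (‖MvPowerSeries.coeff p.1 f‖ * r ^ p.1.degree) * (‖coeff p.2 H‖ * r ^ p.2.degree) := by
    intro m
    have h1 := congrArg (MvPowerSeries.coeff m) hmul
    rw [MvPowerSeries.coeff_mul, MvPowerSeries.coeff_one] at h1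
    rw [← Finset.sum_filter_add_sum_filter_not _ (fun p : (Fin n →₀ ℕ) × (Fin n →₀ ℕ) => p.2 ≠ 0)]
      at h1
    have h2 : (Finset.HasAntidiagonal.antidiagonal m).filter (fun p => ¬ p.2 ≠ 0) = {(m, 0)} := by
      ext ⟨a, b⟩
      simp only [Finset.mem_filter, Finset.HasAntidiagonal.mem_antidiagonal, not_not, Finset.mem_singleton,
        Prod.mk.injEq]
      constructor
      · rintro ⟨h, rfl⟩; exact ⟨by simpa using h, rfl⟩
      · rintro ⟨rfl, rfl⟩; simp
    rw [h2, Finset.sum_singleton, MvPowerSeries.coeff_zero_eq_constantCoeff_apply] at h1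
    have h3 : MvPowerSeries.coeff m f *
        MvPowerSeries.constantCoeff (H : MvPowerSeries (Fin n) ℂ) = (if m = 0 then 1 else 0) -
        ∑ p ∈ (Finset.HasAntidiagonal.antidiagonal m).filter (fun p => p.2 ≠ 0),
          MvPowerSeries.coeff p.1 f * MvPowerSeries.coeff p.2 (H : MvPowerSeries (Fin n) ℂ) := by
      linear_combination h1
    have h4 : c * ‖MvPowerSeries.coeff m f‖ ≤ (if m = 0 then 1 else 0) +
        ∑ p ∈ (Finset.HasAntidiagonal.antidiagonal m).filter (fun p => p.2 ≠ 0),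
          ‖MvPowerSeries.coeff p.1 f‖ * ‖coeff p.2 H‖ := by
      rw [mul_comm, hc, ← norm_mul, h3]
      refine (norm_sub_le _ _).trans (add_le_add ?_ ((norm_sum_le _ _).trans ?_))
      · split_ifs <;> simp
      · refine Finset.sum_le_sum fun p _ => ?_
        rw [norm_mul, coeff_coe]
    calc c * (‖MvPowerSeries.coeff m f‖ * r ^ m.degree)
        = (c * ‖MvPowerSeries.coeff m f‖) * r ^ m.degree := by ring
      _ ≤ _ := mul_le_mul_of_nonneg_right h4 (by positivity)
      _ = _ := by
        rw [add_mul, Finset.sum_mul]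
        congr 1
        · split_ifs with h
          · simp [h]
          · simp
        · refine Finset.sum_congr rfl fun p hp => ?_
          have : m = p.1 + p.2 := (Finset.HasAntidiagonal.mem_antidiagonal.1 (Finset.mem_filter.1 hp).1).symm
          rw [this, map_add, pow_add]
          ring
  refine summable_of_sum_le (c := 2 / c) (fun m => by positivity) fun T => ?_
  -- The box below `M` is closed under passing to smaller exponents, so the recursion stays inside
  -- it.
  set M := T.sup id with hM
  have hTM : T ⊆ Finset.Iic M := fun m hm => Finset.mem_Iic.2 (Finset.le_sup (f := id) hm)
  refine (Finset.sum_le_sum_of_subset_of_nonneg hTM fun _ _ _ => by positivity).trans ?_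
  set B := ∑ m ∈ Finset.Iic M, ‖MvPowerSeries.coeff m f‖ * r ^ m.degree with hB
  have hB0 : 0 ≤ B := by positivity
  have key : c * B ≤ 1 + B * (c / 2) := by
    calc c * B ≤ ∑ m ∈ Finset.Iic M, ((if m = 0 then 1 else 0) +
          ∑ p ∈ (Finset.HasAntidiagonal.antidiagonal m).filter (fun p => p.2 ≠ 0),
          (‖MvPowerSeries.coeff p.1 f‖ * r ^ p.1.degree) *
            (‖coeff p.2 H‖ * r ^ p.2.degree)) := by
          rw [hB, Finset.mul_sum]
          exact Finset.sum_le_sum fun m _ => hrec m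
      _ ≤ 1 + B * ∑ k ∈ H.support.erase 0, ‖coeff k H‖ * r ^ k.degree := by
          rw [Finset.sum_add_distrib, Finset.sum_ite_eq', if_pos (Finset.mem_Iic.2 (by simp)),
            hB, Finset.sum_mul_sum, ← Finset.sum_product', Finset.sum_sigma']
          gcongr
          -- A pair `p` determines its sum `m`, so the double sum has no repetition and is bounded
          -- by the sum over the full product.
          refine ((Finset.sum_image (f := fun p : (Fin n →₀ ℕ) × (Fin n →₀ ℕ) =>
            (‖MvPowerSeries.coeff p.1 f‖ * r ^ p.1.degree) *
              (‖coeff p.2 H‖ * r ^ p.2.degree)) (g := fun q :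
                (_ : Fin n →₀ ℕ) × (Fin n →₀ ℕ) × (Fin n →₀ ℕ) => q.2) ?_).symm.le).trans ?_
          rotate_left
          · rw [← Finset.sum_filter_ne_zero]
            refine Finset.sum_le_sum_of_subset_of_nonneg (fun p hp => ?_)
              fun _ _ _ => by positivity
            simp only [Finset.mem_filter, Finset.mem_image, Finset.mem_sigma, Finset.mem_Iic,
              Finset.HasAntidiagonal.mem_antidiagonal] at hp
            obtain ⟨⟨q, ⟨hqM, hq, hq0⟩, rfl⟩, hne⟩ := hp
            simp only [Finset.mem_product, Finset.mem_Iic, Finset.mem_erase, mem_support_iff]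
            refine ⟨le_trans ?_ hqM, hq0, fun h => hne (by simp [h])⟩
            rw [← hq]
            exact le_self_add
          · rintro ⟨m, p⟩ hp ⟨m', p'⟩ hp' h
            simp only [Finset.coe_sigma, Set.mem_sigma_iff, Finset.coe_filter, Set.mem_ofPred_eq,
              Finset.HasAntidiagonal.mem_antidiagonal] at hp hp' h
            subst h
            rw [← hp.2.1, ← hp'.2.1]
      _ ≤ 1 + B * (c / 2) := by gcongr
  rw [le_div_iff₀ hc0]
  nlinarith

theorem exists_absConvAt_taylorSeries (G : MvPolynomial (Fin n) ℂ) {H : MvPolynomial (Fin n) ℂ}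
    (hH : eval 0 H ≠ 0) : ∃ r : ℝ, 0 < r ∧ AbsConvAt (taylorSeries G H) fun _ => (r : ℂ) := by
  obtain ⟨r, hr, h⟩ := exists_absConvAt_inv hH
  refine ⟨r, hr, ?_⟩
  rw [taylorSeries, mul_comm]
  exact (h.mul_coe G).1

/-- Absolute convergence depends only on the moduli and passes to smaller ones: the domain is a
union of open polydiscs on whose closures the series converges. -/
theorem mem_domainOfConvergence_iff {G H : MvPolynomial (Fin n) ℂ} {z : Fin n → ℂ} :
    z ∈ domainOfConvergence G H ↔
      ∃ r : Fin n → ℝ, (∀ i, ‖z i‖ < r i) ∧ AbsConvAt (taylorSeries G H) fun i => (r i : ℂ) := by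
  constructor
  · intro hz
    obtain ⟨ε, hε, hball⟩ := Metric.isOpen_iff.1 isOpen_interior z hz
    -- Every coordinate is pushed outwards by `ε / 2` in modulus; a zero coordinate has no argument
    -- and moves along the real axis.
    let w : Fin n → ℂ := fun i => if z i = 0 then ((ε / 2 : ℝ) : ℂ) else
      z i + ((ε / 2 : ℝ) : ℂ) * (z i / ‖z i‖)
    have hnz : ∀ i, z i ≠ 0 → (‖z i‖ : ℂ) ≠ 0 := fun i h => by
      exact_mod_cast (norm_pos_iff.2 h).ne'
    have hw : ∀ i, ‖w i‖ = ‖z i‖ + ε / 2 := by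
      intro i
      by_cases h : z i = 0
      · simp only [w, h, if_true, norm_zero, zero_add, Complex.norm_real]
        exact Real.norm_of_nonneg (by positivity)
      · have : w i = z i * (((‖z i‖ + ε / 2) / ‖z i‖ : ℝ) : ℂ) := by
          have := hnz i h
          simp only [w, h, if_false]
          push_cast
          field_simp
        rw [this, norm_mul, Complex.norm_real, Real.norm_of_nonneg (by positivity),
          mul_div_cancel₀ _ (norm_pos_iff.2 h).ne']
    have hwz : w ∈ Metric.ball z ε := by
      rw [Metric.mem_ball, dist_pi_lt_iff hε]
      intro i
      rw [Complex.dist_eq]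
      by_cases h : z i = 0
      · simp only [w, h, if_true, sub_zero, Complex.norm_real]
        rw [Real.norm_of_nonneg (by positivity)]
        linarith
      · have := hnz i h
        simp only [w, h, if_false, add_sub_cancel_left]
        rw [norm_mul, norm_div, Complex.norm_real, Complex.norm_real, norm_norm,
          div_self (norm_pos_iff.2 h).ne', mul_one, Real.norm_of_nonneg (by positivity)]
        linarith
    refine ⟨fun i => ‖w i‖, fun i => ?_, ?_⟩
    · change ‖z i‖ < ‖w i‖
      rw [hw]
      linarith
    · have hw' : AbsConvAt (taylorSeries G H) w :=
        interior_subset (s := {z | AbsConvAt (taylorSeries G H) z}) (hball hwz)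
      exact hw'.mono fun i => by simp
  · rintro ⟨r, hr, h⟩
    refine mem_interior.2 ⟨{w | ∀ i, ‖w i‖ < r i}, fun w hw => ?_, ?_, hr⟩
    · refine AbsConvAt.mono h fun i => ?_
      rw [Complex.norm_real]
      exact (hw i).le.trans (le_abs_self _)
    · rw [Set.ofPred_forall]
      exact isOpen_iInter_of_finite fun i =>
        isOpen_lt (continuous_apply i).norm continuous_const

theorem domainOfConvergence_mono {G H : MvPolynomial (Fin n) ℂ} {z w : Fin n → ℂ}
    (hz : z ∈ domainOfConvergence G H) (hw : ∀ i, ‖w i‖ ≤ ‖z i‖) :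
    w ∈ domainOfConvergence G H := by
  rw [mem_domainOfConvergence_iff] at hz ⊢
  obtain ⟨r, hr, h⟩ := hz
  exact ⟨r, fun i => (hw i).trans_lt (hr i), h⟩

theorem absConvAt_of_mem {G H : MvPolynomial (Fin n) ℂ} {z : Fin n → ℂ}
    (hz : z ∈ domainOfConvergence G H) : AbsConvAt (taylorSeries G H) z :=
  interior_subset (s := {z | AbsConvAt (taylorSeries G H) z}) hz

/-! ### Restriction to a line through the origin -/

/-- The restriction of a polynomial to a line through the origin. -/
def linePoly (q : Fin n → ℂ) (p : MvPolynomial (Fin n) ℂ) : Polynomial ℂ :=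
  aeval (fun i => Polynomial.C (q i) * Polynomial.X) p

/-- The restriction of a power series to a line through the origin. -/
def lineSeries (q : Fin n → ℂ) (f : MvPowerSeries (Fin n) ℂ) : PowerSeries ℂ :=
  PowerSeries.mk fun N => ∑ m ∈ Finset.univ.finsuppAntidiag N,
    MvPowerSeries.coeff m f * ∏ i, q i ^ m i

theorem eval_linePoly (q : Fin n → ℂ) (p : MvPolynomial (Fin n) ℂ) (s : ℂ) :
    (linePoly q p).eval s = eval (fun i => s * q i) p := by
  rw [linePoly]
  induction p using MvPolynomial.induction_on with
  | C a => simp [Polynomial.algebraMap_eq]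
  | add p r hp hr => rw [map_add, Polynomial.eval_add, hp, hr, map_add]
  | mul_X p i hp => rw [map_mul, Polynomial.eval_mul, hp, map_mul, aeval_X, eval_X,
      Polynomial.eval_mul, Polynomial.eval_C, Polynomial.eval_X, mul_comm (q i)]

theorem mem_finsuppAntidiag_univ {N : ℕ} {m : Fin n →₀ ℕ} :
    m ∈ (Finset.univ : Finset (Fin n)).finsuppAntidiag N ↔ ∑ i, m i = N := by
  simp [Finset.mem_finsuppAntidiag]

theorem lineSeries_mul_X (q : Fin n → ℂ) (f : MvPowerSeries (Fin n) ℂ) (i : Fin n) :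
    lineSeries q (f * MvPowerSeries.X i) =
      lineSeries q f * (PowerSeries.C (q i) * PowerSeries.X) := by
  classical
  have hsum : ∀ m : Fin n →₀ ℕ, ∑ j, (m + Finsupp.single i 1 : Fin n →₀ ℕ) j = ∑ j, m j + 1 := by
    intro m
    simp [Finset.sum_add_distrib]
  have hprod : ∀ (m : Fin n →₀ ℕ),
      ∏ j, q j ^ ((m + Finsupp.single i 1 : Fin n →₀ ℕ) j) = (∏ j, q j ^ m j) * q i := by
    intro m
    simp only [Finsupp.add_apply, pow_add, Finset.prod_mul_distrib]
    congr 1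
    rw [Finset.prod_eq_single i]
    · simp
    · intro j _ hj
      simp [hj.symm]
    · simp
  ext N
  rw [← mul_assoc]
  cases N with
  | zero =>
    rw [PowerSeries.coeff_zero_mul_X, lineSeries, PowerSeries.coeff_mk]
    refine Finset.sum_eq_zero fun m hm => ?_
    rw [MvPowerSeries.X, MvPowerSeries.coeff_mul_monomial, if_neg, zero_mul]
    intro hle
    rw [mem_finsuppAntidiag_univ, ← tsub_add_cancel_of_le hle, hsum] at hm
    omega
  | succ N =>
    rw [PowerSeries.coeff_succ_mul_X, PowerSeries.coeff_mul_C, lineSeries, lineSeries,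
      PowerSeries.coeff_mk, PowerSeries.coeff_mk, Finset.sum_mul]
    symm
    refine Finset.sum_of_injOn (fun m => m + Finsupp.single i 1) (fun _ _ _ _ h => by simpa using h)
      (fun m hm => ?_) (fun m hm hm' => ?_) fun m _ => ?_
    · rw [Finset.mem_coe, mem_finsuppAntidiag_univ] at hm ⊢
      rw [hsum, hm]
    · rw [MvPowerSeries.X, MvPowerSeries.coeff_mul_monomial, if_neg, zero_mul]
      intro hle
      refine hm' ⟨m - Finsupp.single i 1, ?_, tsub_add_cancel_of_le hle⟩
      rw [mem_finsuppAntidiag_univ, ← tsub_add_cancel_of_le hle, hsum] at hm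
      rw [Finset.mem_coe, mem_finsuppAntidiag_univ]
      omega
    · rw [hprod, MvPowerSeries.X, MvPowerSeries.coeff_add_mul_monomial]
      ring

theorem lineSeries_mul_coe (q : Fin n → ℂ) (f : MvPowerSeries (Fin n) ℂ)
    (p : MvPolynomial (Fin n) ℂ) :
    lineSeries q (f * (p : MvPowerSeries (Fin n) ℂ)) =
      lineSeries q f * (linePoly q p : PowerSeries ℂ) := by
  induction p using MvPolynomial.induction_on with
  | C a =>
    ext N
    simp [linePoly, lineSeries, Polynomial.algebraMap_eq, Finset.sum_mul, MvPowerSeries.coeff_mul_C,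
      mul_right_comm]
  | add p r hp hr =>
    have h : ∀ f g : MvPowerSeries (Fin n) ℂ,
        lineSeries q (f + g) = lineSeries q f + lineSeries q g := by
      intro f g
      ext N
      simp [lineSeries, add_mul, Finset.sum_add_distrib]
    rw [coe_add, mul_add, h, hp, hr, ← mul_add, ← Polynomial.coe_add, linePoly, linePoly, linePoly,
      map_add]
  | mul_X p i hp =>
    rw [coe_mul, coe_X, ← mul_assoc, lineSeries_mul_X, hp, linePoly, linePoly, map_mul,
      aeval_X, Polynomial.coe_mul, Polynomial.coe_mul, Polynomial.coe_C, Polynomial.coe_X, mul_assoc]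

theorem lineSeries_one (q : Fin n → ℂ) : lineSeries q 1 = 1 := by
  classical
  ext N
  rw [lineSeries, PowerSeries.coeff_mk, PowerSeries.coeff_one]
  split_ifs with h
  · subst h
    rw [Finset.sum_eq_single 0]
    · simp
    · intro m _ hm
      rw [MvPowerSeries.coeff_one, if_neg hm, zero_mul]
    · intro h
      exact absurd (by simp) h
  · refine Finset.sum_eq_zero fun m hm => ?_
    rw [MvPowerSeries.coeff_one, if_neg, zero_mul]
    rintro rfl
    rw [mem_finsuppAntidiag_univ] at hm
    exact h (by simpa using hm.symm)

theorem lineSeries_coe (q : Fin n → ℂ) (p : MvPolynomial (Fin n) ℂ) :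
    lineSeries q (p : MvPowerSeries (Fin n) ℂ) = (linePoly q p : PowerSeries ℂ) := by
  rw [← one_mul (p : MvPowerSeries (Fin n) ℂ), lineSeries_mul_coe, lineSeries_one, one_mul]

/-- A polynomial containing a pure power of a variable vanishes somewhere on the coordinate axis. -/
theorem exists_root_on_axis {H : MvPolynomial (Fin n) ℂ} (i : Fin n) {d : ℕ} (hd : 0 < d)
    (h : coeff (Finsupp.single i d) H ≠ 0) : ∃ u : ℂ, eval (Pi.single i u) H = 0 := by
  classical
  -- On the axis only the pure powers of the `i`-th variable survive.
  have hc : (linePoly (Pi.single i 1) H).coeff d = coeff (Finsupp.single i d) H := by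
    rw [← Polynomial.coeff_coe, ← lineSeries_coe, lineSeries, PowerSeries.coeff_mk,
      Finset.sum_eq_single (Finsupp.single i d)]
    · rw [coeff_coe, Finset.prod_eq_one, mul_one]
      intro j _
      by_cases hj : j = i
      · subst hj; simp
      · simp [Ne.symm hj]
    · intro m hm hne
      rw [mem_finsuppAntidiag_univ] at hm
      obtain ⟨j, hj, hmj⟩ : ∃ j, j ≠ i ∧ m j ≠ 0 := by
        by_contra! hcon
        refine hne (Finsupp.ext fun j => ?_)
        by_cases hj : j = i
        · subst hj
          rw [Finset.sum_eq_single j (fun k _ hk => hcon k hk) (by simp)] at hm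
          simp [hm]
        · simp [hcon j hj, Ne.symm hj]
      rw [Finset.prod_eq_zero (Finset.mem_univ j), mul_zero]
      simp [hmj, hj]
    · intro h
      exact absurd (by simp) h
  have hdeg : 0 < (linePoly (Pi.single i 1) H).degree := by
    refine lt_of_lt_of_le ?_ (Polynomial.le_degree_of_ne_zero (hc ▸ h))
    exact_mod_cast hd
  obtain ⟨u, hu⟩ := Complex.exists_root hdeg
  refine ⟨u, ?_⟩
  rw [Polynomial.IsRoot, eval_linePoly] at hu
  refine (congrArg (fun z => eval z H) (funext fun j => ?_)).trans hu
  by_cases hj : j = i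
  · subst hj; simp
  · simp [hj]

/-! ### Univariate rational series -/

/-- Absolute convergence of a univariate power series on the closed disc of radius `R`. -/
def SummableOnDisc (f : PowerSeries ℂ) (R : ℝ) : Prop :=
  Summable fun N => ‖PowerSeries.coeff N f‖ * R ^ N

theorem SummableOnDisc.mul {f g : PowerSeries ℂ} {R : ℝ} (hR : 0 ≤ R) (hf : SummableOnDisc f R)
    (hg : SummableOnDisc g R) : SummableOnDisc (f * g) R := by
  have hn : ∀ (f : PowerSeries ℂ) N,
      ‖PowerSeries.coeff N f * (R : ℂ) ^ N‖ = ‖PowerSeries.coeff N f‖ * R ^ N := by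
    intro f N
    rw [norm_mul, norm_pow, Complex.norm_real, Real.norm_of_nonneg hR]
  have h := summable_norm_sum_mul_antidiagonal_of_summable_norm
    (f := fun N => PowerSeries.coeff N f * (R : ℂ) ^ N)
    (g := fun N => PowerSeries.coeff N g * (R : ℂ) ^ N)
    (hf.congr fun N => (hn f N).symm) (hg.congr fun N => (hn g N).symm)
  refine h.congr fun N => ?_
  rw [← hn, PowerSeries.coeff_mul, Finset.sum_mul]
  congr 1
  refine Finset.sum_congr rfl fun p hp => ?_
  rw [← Finset.HasAntidiagonal.mem_antidiagonal.1 hp, pow_add]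
  ring

theorem summableOnDisc_coe (p : Polynomial ℂ) (R : ℝ) : SummableOnDisc (p : PowerSeries ℂ) R :=
  summable_of_ne_finset_zero (s := p.support) fun N hN => by
    rw [Polynomial.coeff_coe, Polynomial.notMem_support_iff.1 hN, norm_zero, zero_mul]

theorem SummableOnDisc.of_mul_X_sub_C {f : PowerSeries ℂ} {R : ℝ} {r : ℂ} (hR : 0 ≤ R)
    (hr : R < ‖r‖)
    (h : SummableOnDisc (f * ((Polynomial.X - Polynomial.C r : Polynomial ℂ) : PowerSeries ℂ)) R) :
    SummableOnDisc f R := by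
  have hr0 : r ≠ 0 := norm_pos_iff.1 (hR.trans_lt hr)
  -- The geometric expansion of `1 / (X - r)`, which converges for moduli below `‖r‖`.
  let g : PowerSeries ℂ := PowerSeries.mk fun N => -(r⁻¹ ^ (N + 1))
  have hg : SummableOnDisc g R := by
    have hlt : R / ‖r‖ < 1 := (div_lt_one (hR.trans_lt hr)).2 hr
    refine ((summable_geometric_of_lt_one (by positivity) hlt).mul_left ‖r‖⁻¹).congr fun N => ?_
    rw [PowerSeries.coeff_mk, norm_neg, norm_pow, norm_inv, div_pow, pow_succ, inv_pow]
    field_simp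
  have hmul : ((Polynomial.X - Polynomial.C r : Polynomial ℂ) : PowerSeries ℂ) * g = 1 := by
    ext N
    rw [Polynomial.coe_sub, Polynomial.coe_X, Polynomial.coe_C, sub_mul, map_sub,
      PowerSeries.coeff_C_mul, PowerSeries.coeff_mk, PowerSeries.coeff_one]
    cases N with
    | zero => simp [hr0]
    | succ N =>
      rw [PowerSeries.coeff_succ_X_mul, PowerSeries.coeff_mk, if_neg (Nat.succ_ne_zero N),
        pow_succ _ (N + 1)]
      field_simp
      ring
  have := h.mul hR hg
  rwa [mul_assoc, hmul, mul_one] at this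

theorem SummableOnDisc.of_mul_prod {f : PowerSeries ℂ} {R : ℝ} (hR : 0 ≤ R) (s : Multiset ℂ)
    (hs : ∀ r ∈ s, R < ‖r‖) (h : SummableOnDisc
      (f * (((s.map fun r => Polynomial.X - Polynomial.C r).prod : Polynomial ℂ) : PowerSeries ℂ))
        R) : SummableOnDisc f R := by
  induction s using Multiset.induction_on generalizing f with
  | empty => simpa using h
  | cons r s ih =>
    rw [Multiset.map_cons, Multiset.prod_cons, Polynomial.coe_mul, ← mul_assoc] at h
    exact (ih (fun x hx => hs x (Multiset.mem_cons_of_mem hx)) h).of_mul_X_sub_C hR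
      (hs r (Multiset.mem_cons_self r s))

theorem SummableOnDisc.tsum_mul_eval {f : PowerSeries ℂ} {r : ℂ} (hf : SummableOnDisc f ‖r‖)
    {g h : Polynomial ℂ} (hfg : f * (h : PowerSeries ℂ) = g) :
    (∑' N, PowerSeries.coeff N f * r ^ N) * h.eval r = g.eval r := by
  have heval : ∀ p : Polynomial ℂ,
      ∑' N, PowerSeries.coeff N (p : PowerSeries ℂ) * r ^ N = p.eval r := by
    intro p
    rw [Polynomial.eval_eq_sum, Polynomial.sum, tsum_eq_sum (s := p.support)]
    · exact Finset.sum_congr rfl fun N _ => by rw [Polynomial.coeff_coe]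
    · intro N hN
      rw [Polynomial.coeff_coe, Polynomial.notMem_support_iff.1 hN, zero_mul]
  have hn : ∀ (f : PowerSeries ℂ) N,
      ‖PowerSeries.coeff N f * r ^ N‖ = ‖PowerSeries.coeff N f‖ * ‖r‖ ^ N := by
    intro f N
    rw [norm_mul, norm_pow]
  rw [← heval h, ← heval g, tsum_mul_tsum_eq_tsum_sum_antidiagonal_of_summable_norm
    (hf.congr fun N => (hn f N).symm) ((summableOnDisc_coe h ‖r‖).congr fun N => (hn _ N).symm)]
  refine tsum_congr fun N => ?_
  rw [← hfg, PowerSeries.coeff_mul, Finset.sum_mul]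
  refine Finset.sum_congr rfl fun p hp => ?_
  rw [← Finset.HasAntidiagonal.mem_antidiagonal.1 hp, pow_add]
  ring

/-- If the expansion of a rational function converges absolutely on the closed unit disc, then it
does so on a larger disc. -/
theorem SummableOnDisc.exists_gt_one {f : PowerSeries ℂ} {g h : Polynomial ℂ}
    (hf : SummableOnDisc f 1) (h0 : h ≠ 0) (hfg : f * (h : PowerSeries ℂ) = g) :
    ∃ R : ℝ, 1 < R ∧ SummableOnDisc f R := by
  classical
  -- In lowest terms the denominator has no root in the closed unit disc: the series converges
  -- there, so the numerator would vanish as well, against Bézout.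
  set d := EuclideanDomain.gcd h g with hd
  have hd0 : d ≠ 0 := fun h' => h0 (EuclideanDomain.gcd_eq_zero_iff.1 h').1
  obtain ⟨h₁, hh⟩ := EuclideanDomain.gcd_dvd_left h g
  obtain ⟨g₁, hg⟩ := EuclideanDomain.gcd_dvd_right h g
  rw [← hd] at hh hg
  have hcop : ∃ a b, a * h₁ + b * g₁ = 1 := by
    refine ⟨EuclideanDomain.gcdA h g, EuclideanDomain.gcdB h g, mul_left_cancel₀ hd0 ?_⟩
    have := EuclideanDomain.gcd_eq_gcd_ab h g
    rw [← hd] at this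
    calc d * (EuclideanDomain.gcdA h g * h₁ + EuclideanDomain.gcdB h g * g₁)
        = (d * h₁) * EuclideanDomain.gcdA h g + (d * g₁) * EuclideanDomain.gcdB h g := by ring
      _ = d * 1 := by rw [← hh, ← hg, ← this, mul_one]
  have hfg₁ : f * (h₁ : PowerSeries ℂ) = g₁ := by
    have hd0' : (d : PowerSeries ℂ) ≠ 0 := by
      rwa [Ne, Polynomial.coe_eq_zero_iff]
    refine mul_left_cancel₀ hd0' ?_
    rw [mul_left_comm, ← Polynomial.coe_mul, ← Polynomial.coe_mul, ← hh, ← hg, hfg]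
  have h₁0 : h₁ ≠ 0 := by
    rintro rfl
    exact h0 (by rw [hh, mul_zero])
  have hroots : ∀ r ∈ h₁.roots, 1 < ‖r‖ := by
    intro r hr
    by_contra! hle
    have hfr : SummableOnDisc f ‖r‖ :=
      Summable.of_nonneg_of_le (fun N => by positivity) (fun N => by gcongr) hf
    have hr0 : h₁.eval r = 0 := (Polynomial.mem_roots h₁0).1 hr
    have hg0 := hfr.tsum_mul_eval hfg₁
    rw [hr0, mul_zero] at hg0
    obtain ⟨a, b, hab⟩ := hcop
    have := congrArg (Polynomial.eval r) hab
    simp [hr0, ← hg0] at this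
  have hR : ∀ s : Multiset ℂ, (∀ r ∈ s, 1 < ‖r‖) → ∃ R : ℝ, 1 < R ∧ ∀ r ∈ s, R < ‖r‖ := by
    intro s
    induction s using Multiset.induction_on with
    | empty => exact fun _ => ⟨2, one_lt_two, by simp⟩
    | cons r s ih =>
      intro hs
      obtain ⟨R, hR1, hR⟩ := ih fun x hx => hs x (Multiset.mem_cons_of_mem hx)
      obtain ⟨R', hR'1, hR'⟩ := exists_between (hs r (Multiset.mem_cons_self r s))
      refine ⟨min R R', lt_min hR1 hR'1, fun x hx => ?_⟩
      rcases Multiset.mem_cons.1 hx with rfl | hx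
      · exact (min_le_right _ _).trans_lt hR'
      · exact (min_le_left _ _).trans_lt (hR x hx)
  obtain ⟨R, hR1, hR⟩ := hR _ hroots
  have hR0 : 0 ≤ R := zero_le_one.trans hR1.le
  refine ⟨R, hR1, SummableOnDisc.of_mul_prod hR0 h₁.roots hR ?_⟩
  have hsplit : h₁ = Polynomial.C h₁.leadingCoeff *
      (h₁.roots.map fun r => Polynomial.X - Polynomial.C r).prod :=
    (IsAlgClosed.splits h₁).eq_prod_roots
  have hlc : h₁.leadingCoeff ≠ 0 := Polynomial.leadingCoeff_ne_zero.2 h₁0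
  have : f * (((h₁.roots.map fun r => Polynomial.X - Polynomial.C r).prod : Polynomial ℂ) :
      PowerSeries ℂ) = ((Polynomial.C h₁.leadingCoeff⁻¹ * g₁ : Polynomial ℂ) : PowerSeries ℂ) := by
    have h2 : (h₁.roots.map fun r => Polynomial.X - Polynomial.C r).prod =
        Polynomial.C h₁.leadingCoeff⁻¹ * h₁ := by
      refine Eq.trans ?_ (congrArg (Polynomial.C h₁.leadingCoeff⁻¹ * ·) hsplit.symm)
      rw [← mul_assoc, ← Polynomial.C_mul, inv_mul_cancel₀ hlc, Polynomial.C_1, one_mul]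
    rw [h2, Polynomial.coe_mul, Polynomial.coe_mul, mul_left_comm, hfg₁]
  rw [this]
  exact summableOnDisc_coe _ R

/-! ### Pringsheim's argument on positive rays -/

theorem IsCombinatorial.coeff_eq {G H : MvPolynomial (Fin n) ℂ} (hc : IsCombinatorial G H)
    (m : Fin n →₀ ℕ) : MvPowerSeries.coeff m (taylorSeries G H) =
      (‖MvPowerSeries.coeff m (taylorSeries G H)‖ : ℂ) := by
  obtain ⟨h1, h2⟩ := hc m
  set a := MvPowerSeries.coeff m (taylorSeries G H)
  have : a = (a.re : ℂ) := Complex.ext (by simp) (by simp [h2])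
  rw [this, Complex.norm_real, Real.norm_of_nonneg h1]

theorem IsCombinatorial.coeff_mul_prod {G H : MvPolynomial (Fin n) ℂ} (hc : IsCombinatorial G H)
    {q : Fin n → ℝ} (hq : ∀ i, 0 ≤ q i) (m : Fin n →₀ ℕ) :
    MvPowerSeries.coeff m (taylorSeries G H) * ∏ i, (q i : ℂ) ^ m i =
      ((‖MvPowerSeries.coeff m (taylorSeries G H)‖ * ∏ i, ‖(q i : ℂ)‖ ^ m i : ℝ) : ℂ) := by
  rw [hc.coeff_eq m]
  push_cast
  congr 1
  · simp
  · exact Finset.prod_congr rfl fun i _ => by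
      rw [Complex.norm_real, Real.norm_of_nonneg (hq i)]

/-- Absolute convergence at a positive point which is not a pole, from convergence below it. -/
theorem IsCombinatorial.absConvAt {G H : MvPolynomial (Fin n) ℂ} (hc : IsCombinatorial G H)
    (hH0 : eval 0 H ≠ 0) {q : Fin n → ℝ} (hq : ∀ i, 0 ≤ q i)
    (ht : ∀ t : ℝ, 0 ≤ t → t < 1 →
      (fun i => ((t * q i : ℝ) : ℂ)) ∈ domainOfConvergence G H)
    (hne : eval (fun i => (q i : ℂ)) H ≠ 0) :
    AbsConvAt (taylorSeries G H) fun i => (q i : ℂ) := by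
  have hcont : ∀ p : MvPolynomial (Fin n) ℂ,
      Continuous fun t : ℝ => eval (fun i => ((t * q i : ℝ) : ℂ)) p := by
    intro p
    refine (MvPolynomial.continuous_eval p).comp (continuous_pi fun i => ?_)
    fun_prop
  have hlim : Tendsto (fun t : ℝ => ‖eval (fun i => ((t * q i : ℝ) : ℂ)) G /
      eval (fun i => ((t * q i : ℝ) : ℂ)) H‖) (𝓝[<] 1) (𝓝 ‖eval (fun i => (q i : ℂ)) G /
      eval (fun i => (q i : ℂ)) H‖) := by
    have h1 := ((hcont G).tendsto 1)
    have h2 := ((hcont H).tendsto 1)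
    simp only [one_mul] at h1 h2
    exact ((h1.div h2 hne).norm).mono_left nhdsWithin_le_nhds
  -- The terms are non-negative, so for `t < 1` close to `1` each finite sum at `t q` is at most the
  -- value of `G / H` there; let `t` tend to `1`.
  refine summable_of_sum_le (c := ‖eval (fun i => (q i : ℂ)) G / eval (fun i => (q i : ℂ)) H‖)
    (fun m => by positivity) fun T => ?_
  have hT : Tendsto (fun t : ℝ => ∑ m ∈ T, ‖MvPowerSeries.coeff m (taylorSeries G H)‖ *
      ∏ i, ‖((t * q i : ℝ) : ℂ)‖ ^ m i) (𝓝[<] 1)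
      (𝓝 (∑ m ∈ T, ‖MvPowerSeries.coeff m (taylorSeries G H)‖ * ∏ i, ‖(q i : ℂ)‖ ^ m i)) := by
    have : Continuous fun t : ℝ => ∑ m ∈ T, ‖MvPowerSeries.coeff m (taylorSeries G H)‖ *
      ∏ i, ‖((t * q i : ℝ) : ℂ)‖ ^ m i := by fun_prop
    have h1 := this.tendsto 1
    simp only [one_mul] at h1
    exact h1.mono_left nhdsWithin_le_nhds
  refine le_of_tendsto_of_tendsto hT hlim ?_
  have hne' : ∀ᶠ t : ℝ in 𝓝[<] 1, eval (fun i => ((t * q i : ℝ) : ℂ)) H ≠ 0 := by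
    refine nhdsWithin_le_nhds ((hcont H).continuousAt.eventually_ne ?_)
    simpa using hne
  have hpos : ∀ᶠ t : ℝ in 𝓝[<] 1, 0 < t := nhdsWithin_le_nhds (lt_mem_nhds one_pos)
  filter_upwards [hne', hpos, self_mem_nhdsWithin] with t h1 h2 h3
  have habs := absConvAt_of_mem (ht t h2.le h3)
  have hs := sumAt_taylorSeries hH0 habs
  rw [← hs, mul_div_cancel_right₀ _ h1, sumAt]
  have hq' : ∀ i, 0 ≤ t * q i := fun i => mul_nonneg h2.le (hq i)
  simp only [hc.coeff_mul_prod hq']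
  rw [← Complex.ofReal_tsum, Complex.norm_real]
  refine le_trans ?_ (le_abs_self _)
  exact habs.sum_le_tsum T fun m _ => by positivity

/-- A positive point which is not a pole, and below which the expansion of a
combinatorial fraction converges, belongs to the domain of convergence. -/
theorem IsCombinatorial.mem_domainOfConvergence {G H : MvPolynomial (Fin n) ℂ}
    (hc : IsCombinatorial G H) (hH0 : eval 0 H ≠ 0) {q : Fin n → ℝ} (hq : ∀ i, 0 < q i)
    (ht : ∀ t : ℝ, 0 ≤ t → t < 1 →
      (fun i => ((t * q i : ℝ) : ℂ)) ∈ domainOfConvergence G H)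
    (hne : eval (fun i => (q i : ℂ)) H ≠ 0) :
    (fun i => (q i : ℂ)) ∈ domainOfConvergence G H := by
  have habs := hc.absConvAt hH0 (fun i => (hq i).le) ht hne
  set c : (Fin n →₀ ℕ) → ℝ := fun m =>
    ‖MvPowerSeries.coeff m (taylorSeries G H)‖ * ∏ i, ‖(q i : ℂ)‖ ^ m i with hcdef
  have hc0 : ∀ m, 0 ≤ c m := fun m => by positivity
  set f := lineSeries (fun i => (q i : ℂ)) (taylorSeries G H) with hf
  -- Positivity excludes cancellation when terms are grouped by total degree, so convergence on the
  -- ray and absolute convergence in several variables are equivalent.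
  have hcoeff : ∀ N, ‖PowerSeries.coeff N f‖ = ∑ m ∈ Finset.univ.finsuppAntidiag N, c m := by
    intro N
    rw [hf, lineSeries, PowerSeries.coeff_mk]
    simp only [hc.coeff_mul_prod fun i => (hq i).le]
    rw [← Complex.ofReal_sum, Complex.norm_real, Real.norm_of_nonneg]
    exact Finset.sum_nonneg fun m _ => hc0 m
  have hdisj : Pairwise fun N N' : ℕ => Disjoint
      ((Finset.univ : Finset (Fin n)).finsuppAntidiag N) (Finset.univ.finsuppAntidiag N') := by
    intro N N' hNN'
    refine Finset.disjoint_left.2 fun m hm hm' => hNN' ?_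
    rw [mem_finsuppAntidiag_univ] at hm hm'
    exact hm.symm.trans hm'
  have hf1 : SummableOnDisc f 1 := by
    refine summable_of_sum_le (c := ∑' m, c m) (fun N => by positivity) fun T => ?_
    simp only [one_pow, mul_one, hcoeff]
    rw [← Finset.sum_biUnion fun N _ N' _ h => hdisj h]
    exact habs.sum_le_tsum _ fun m _ => hc0 m
  have hfg : f * (linePoly (fun i => (q i : ℂ)) H : PowerSeries ℂ) =
      (linePoly (fun i => (q i : ℂ)) G : PowerSeries ℂ) := by
    rw [hf, ← lineSeries_mul_coe, taylorSeries_mul G hH0, lineSeries_coe]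
  have hline : linePoly (fun i => (q i : ℂ)) H ≠ 0 := by
    intro h
    refine hH0 ?_
    have := eval_linePoly (fun i => (q i : ℂ)) H 0
    rw [h] at this
    simpa [Pi.zero_def] using this.symm
  obtain ⟨R, hR1, hR⟩ := hf1.exists_gt_one hline hfg
  have hR0 : 0 < R := one_pos.trans hR1
  refine mem_domainOfConvergence_iff.2 ⟨fun i => R * q i, fun i => ?_, ?_⟩
  · rw [Complex.norm_real, Real.norm_of_nonneg (hq i).le]
    exact lt_mul_of_one_lt_left (hq i) hR1
  · have hterm : ∀ m : Fin n →₀ ℕ, ‖MvPowerSeries.coeff m (taylorSeries G H)‖ *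
        ∏ i, ‖((R * q i : ℝ) : ℂ)‖ ^ m i = c m * R ^ (∑ i, m i) := by
      intro m
      rw [hcdef, ← Finset.prod_pow_eq_pow_sum, mul_assoc, ← Finset.prod_mul_distrib]
      congr 1
      refine Finset.prod_congr rfl fun i _ => ?_
      rw [← mul_pow, Complex.norm_real, Complex.norm_real, Real.norm_of_nonneg (hq i).le,
        Real.norm_of_nonneg (mul_pos hR0 (hq i)).le, mul_comm]
    refine summable_of_sum_le (c := ∑' N, ‖PowerSeries.coeff N f‖ * R ^ N)
      (fun m => by positivity) fun T => ?_
    simp only [hterm]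
    calc ∑ m ∈ T, c m * R ^ (∑ i, m i)
        ≤ ∑ m ∈ (T.image fun m => ∑ i, m i).biUnion
            (fun N => (Finset.univ : Finset (Fin n)).finsuppAntidiag N),
            c m * R ^ (∑ i, m i) := by
          refine Finset.sum_le_sum_of_subset_of_nonneg (fun m hm => ?_)
            fun m _ _ => mul_nonneg (hc0 m) (by positivity)
          exact Finset.mem_biUnion.2 ⟨_, Finset.mem_image_of_mem _ hm,
            mem_finsuppAntidiag_univ.2 rfl⟩
      _ = ∑ N ∈ T.image fun m => ∑ i, m i, ‖PowerSeries.coeff N f‖ * R ^ N := by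
          rw [Finset.sum_biUnion fun N _ N' _ h => hdisj h]
          refine Finset.sum_congr rfl fun N _ => ?_
          rw [hcoeff, Finset.sum_mul]
          exact Finset.sum_congr rfl fun m hm => by rw [mem_finsuppAntidiag_univ.1 hm]
      _ ≤ _ := hR.sum_le_tsum _ fun N _ => by positivity

/-- On each positive ray leaving the domain of convergence of a combinatorial fraction there is a
pole, located between the known bounds for the radius. -/
theorem IsCombinatorial.exists_pole_on_ray {G H : MvPolynomial (Fin n) ℂ}
    (hc : IsCombinatorial G H) (hH0 : eval 0 H ≠ 0) {q : Fin n → ℝ} (hq : ∀ i, 0 < q i)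
    {lo hi : ℝ} (hlo : 0 < lo)
    (h1 : ∀ t : ℝ, 0 ≤ t → t < lo → (fun i => ((t * q i : ℝ) : ℂ)) ∈ domainOfConvergence G H)
    (h2 : ∀ t : ℝ, 0 ≤ t → (fun i => ((t * q i : ℝ) : ℂ)) ∈ domainOfConvergence G H → t ≤ hi) :
    ∃ ρ : ℝ, lo ≤ ρ ∧ ρ ≤ hi ∧ eval (fun i => ((ρ * q i : ℝ) : ℂ)) H = 0 := by
  set S : Set ℝ := {t | 0 ≤ t ∧ (fun i => ((t * q i : ℝ) : ℂ)) ∈ domainOfConvergence G H} with hS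
  have hbdd : BddAbove S := ⟨hi, fun t ht => h2 t ht.1 ht.2⟩
  have hne : S.Nonempty := ⟨0, le_rfl, h1 0 le_rfl hlo⟩
  have hloρ : lo ≤ sSup S := le_of_forall_lt fun t ht => by
    obtain ⟨t', ht', ht'lo⟩ := exists_between (max_lt ht hlo)
    have : t' ∈ S := ⟨(le_max_right _ _).trans ht'.le, h1 _ ((le_max_right _ _).trans ht'.le) ht'lo⟩
    exact ((le_max_left _ _).trans_lt ht').trans_le (le_csSup hbdd this)
  have hρ0 : 0 < sSup S := hlo.trans_le hloρ
  refine ⟨sSup S, hloρ, csSup_le hne fun t ht => h2 t ht.1 ht.2, ?_⟩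
  have hbelow : ∀ t : ℝ, 0 ≤ t → t < sSup S →
      (fun i => ((t * q i : ℝ) : ℂ)) ∈ domainOfConvergence G H := by
    intro t ht0 ht
    obtain ⟨s, hs, hts⟩ := exists_lt_of_lt_csSup hne ht
    refine domainOfConvergence_mono hs.2 fun i => ?_
    rw [Complex.norm_real, Complex.norm_real, Real.norm_of_nonneg (mul_nonneg ht0 (hq i).le),
      Real.norm_of_nonneg (mul_nonneg hs.1 (hq i).le)]
    exact mul_le_mul_of_nonneg_right hts.le (hq i).le
  -- Without a pole at the supremum, that point would belong to the open domain, and so would points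
  -- further along the ray.
  by_contra hpole
  have hmem := hc.mem_domainOfConvergence hH0 (q := fun i => sSup S * q i)
    (fun i => mul_pos hρ0 (hq i)) (fun t ht0 ht1 => by
      simp only [← mul_assoc]
      exact hbelow _ (mul_nonneg ht0 hρ0.le) (mul_lt_of_lt_one_left hρ0 ht1)) hpole
  have hcont : Continuous fun t : ℝ => (fun i => ((t * q i : ℝ) : ℂ) : Fin n → ℂ) :=
    continuous_pi fun i => by fun_prop
  have hopen : ∀ᶠ t in 𝓝 (sSup S), (fun i => ((t * q i : ℝ) : ℂ)) ∈ domainOfConvergence G H :=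
    hcont.continuousAt.eventually (isOpen_interior.mem_nhds hmem)
  obtain ⟨t, ht, htρ⟩ := ((hopen.filter_mono nhdsWithin_le_nhds).and
    (self_mem_nhdsWithin (s := Set.Ioi (sSup S)))).exists
  exact absurd (le_csSup hbdd ⟨hρ0.le.trans htρ.le, ht⟩) (not_le.2 htρ)

/-! ### Maximizing the product of the moduli -/

/-- The derivative of a polynomial in logarithmic coordinates. -/
theorem hasFDerivAt_eval_exp (H : MvPolynomial (Fin n) ℂ) (x : Fin n → ℝ) :
    ∃ L : (Fin n → ℝ) →L[ℝ] ℂ,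
      HasFDerivAt (fun u : Fin n → ℝ => eval (fun i => ((x i * Real.exp (u i) : ℝ) : ℂ)) H) L 0 ∧
      ∀ u, L u = ∑ j, (x j : ℂ) * eval (fun i => (x i : ℂ)) (pderiv j H) * u j := by
  let inner' : (Fin n → ℝ) →L[ℝ] (Fin n → ℂ) := ContinuousLinearMap.pi fun i =>
    Complex.ofRealCLM.comp (x i • (ContinuousLinearMap.proj i : (Fin n → ℝ) →L[ℝ] ℝ))
  have hinner : HasFDerivAt
      (fun u : Fin n → ℝ => (fun i => ((x i * Real.exp (u i) : ℝ) : ℂ) : Fin n → ℂ)) inner' 0 := by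
    refine hasFDerivAt_pi.2 fun i => ?_
    have h : HasFDerivAt (fun u : Fin n → ℝ => x i * Real.exp (u i))
        (x i • (ContinuousLinearMap.proj i : (Fin n → ℝ) →L[ℝ] ℝ)) 0 := by
      simpa using ((hasFDerivAt_apply (𝕜 := ℝ) i (0 : Fin n → ℝ)).exp).const_mul (x i)
    exact Complex.ofRealCLM.hasFDerivAt.comp (0 : Fin n → ℝ) h
  have h0 : (fun i => ((x i * Real.exp ((0 : Fin n → ℝ) i) : ℝ) : ℂ)) = fun i => (x i : ℂ) := by
    simp
  have houter := (hasFDerivAt_eval H fun i => (x i : ℂ)).restrictScalars ℝ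
  rw [← h0] at houter
  refine ⟨_, HasFDerivAt.comp (g := fun z => eval z H) (0 : Fin n → ℝ) houter hinner, fun u => ?_⟩
  simp [inner']
  exact Finset.sum_congr rfl fun j _ => by ring

/-- A positive point maximizing the product of the coordinates on the closure of the domain of
convergence of a combinatorial fraction is critical. -/
theorem IsCombinatorial.isCriticalPoint {G H : MvPolynomial (Fin n) ℂ} (hn : 1 ≤ n)
    (hc : IsCombinatorial G H) (hH0 : eval 0 H ≠ 0) {x : Fin n → ℝ} (hx : ∀ i, 0 < x i)
    (hmax : ∀ z ∈ domainOfConvergence G H, ∏ i, ‖z i‖ ≤ ∏ i, x i)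
    (hbelow : ∀ t : ℝ, 0 ≤ t → t < 1 → ∀ w : Fin n → ℂ, (∀ i, ‖w i‖ ≤ t * x i) →
      w ∈ domainOfConvergence G H) : IsCriticalPoint H fun i => (x i : ℂ) := by
  have hxprod : 0 < ∏ i, x i := Finset.prod_pos fun i _ => hx i
  -- poles on the rays close to the ray of `x`
  have hray : ∀ (a : Fin n → ℝ) (τ : ℝ), 0 ≤ τ → (∀ k, a k ≤ 1) → ∑ k, a k = 0 →
      ∃ ρ : ℝ, Real.exp (-τ) ≤ ρ ∧ ρ ≤ 1 ∧
        eval (fun k => ((ρ * (x k * Real.exp (τ * a k)) : ℝ) : ℂ)) H = 0 := by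
    intro a τ hτ ha hsum
    have hq : ∀ k, 0 < x k * Real.exp (τ * a k) := fun k => mul_pos (hx k) (Real.exp_pos _)
    -- Lower bound: as `a k ≤ 1`, the point stays below `x` until `exp (-τ)`. Upper bound: as the `a
    -- k` sum to `0`, the product of the moduli is `t ^ n ∏ x k`, at most `∏ x k` by maximality.
    refine hc.exists_pole_on_ray hH0 hq (Real.exp_pos _) (fun t ht0 ht => ?_) fun t ht0 ht => ?_
    · refine hbelow (t * Real.exp τ) (by positivity) ?_ _ fun k => ?_
      · calc t * Real.exp τ < Real.exp (-τ) * Real.exp τ := by gcongr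
          _ = 1 := by rw [← Real.exp_add, neg_add_cancel, Real.exp_zero]
      · rw [Complex.norm_real, Real.norm_of_nonneg (mul_nonneg ht0 (hq k).le), mul_assoc,
          mul_comm (x k)]
        have : τ * a k ≤ τ := mul_le_of_le_one_right hτ (ha k)
        have hxk := (hx k).le
        gcongr
    · have h := hmax _ ht
      have h2 : ∏ k, ‖((t * (x k * Real.exp (τ * a k)) : ℝ) : ℂ)‖ = t ^ n * ∏ k, x k := by
        have h3 : ∏ k, Real.exp (τ * a k) = 1 := by
          rw [← Real.exp_sum, ← Finset.mul_sum, hsum, mul_zero, Real.exp_zero]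
        calc ∏ k, ‖((t * (x k * Real.exp (τ * a k)) : ℝ) : ℂ)‖
            = ∏ k, t * (x k * Real.exp (τ * a k)) := Finset.prod_congr rfl fun k _ => by
              rw [Complex.norm_real, Real.norm_of_nonneg (mul_nonneg ht0 (hq k).le)]
          _ = _ := by
            rw [Finset.prod_mul_distrib, Finset.prod_mul_distrib, h3, mul_one, Finset.prod_const,
              Finset.card_univ, Fintype.card_fin]
      rw [h2] at h
      have h4 : t ^ n ≤ 1 := le_of_mul_le_mul_right (by rwa [one_mul]) hxprod
      exact (pow_le_one_iff_of_nonneg ht0 (by omega)).1 h4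
  have hHx : eval (fun i => (x i : ℂ)) H = 0 := by
    obtain ⟨ρ, hρ1, hρ2, hρ⟩ := hray 0 0 le_rfl (fun _ => zero_le_one) (by simp)
    have : ρ = 1 := le_antisymm hρ2 (by simpa using hρ1)
    simpa [this] using hρ
  obtain ⟨L, hL, hLu⟩ := hasFDerivAt_eval_exp H x
  set μ : Fin n → ℂ := fun j => (x j : ℂ) * eval (fun i => (x i : ℂ)) (pderiv j H) with hμ
  set M := ∑ j, μ j with hM
  -- For `a = e_i - e_j` the pole has logarithmic displacement `τ (a + r)` from `x`, with `r = log ρ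
  -- / τ` in `[-1, 0]`. As `H` vanishes at both points, its differential there is `o(τ)`.
  have key : ∀ (i j : Fin n) (ε : ℝ), 0 < ε →
      ∃ r : ℝ, -1 ≤ r ∧ r ≤ 0 ∧ ‖μ i - μ j + M * r‖ ≤ ε := by
    intro i j ε hε
    -- The displacement has norm at most `2 τ`: hence the tolerance `ε / 2`, and `τ = δ / 4` to
    -- remain in the ball.
    obtain ⟨δ, hδ, hball⟩ := Metric.eventually_nhds_iff.1
      (hL.isLittleO.def (c := ε / 2) (by positivity))
    set τ := δ / 4 with hτ
    have hτ0 : 0 < τ := by positivity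
    set a : Fin n → ℝ := Pi.single i 1 - Pi.single j 1 with ha
    have ha1 : ∀ k, |a k| ≤ 1 := by
      intro k
      simp only [ha, Pi.sub_apply, Pi.single_apply]
      split_ifs <;> simp
    obtain ⟨ρ, hρ1, hρ2, hρ⟩ := hray a τ hτ0.le (fun k => (le_abs_self _).trans (ha1 k))
      (by simp [ha])
    have hρ0 : 0 < ρ := (Real.exp_pos _).trans_le hρ1
    set r := Real.log ρ / τ with hr
    have hr1 : -1 ≤ r := by
      rw [hr, le_div_iff₀ hτ0, Real.le_log_iff_exp_le hρ0]
      simpa using hρ1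
    have hr2 : r ≤ 0 := div_nonpos_of_nonpos_of_nonneg (Real.log_nonpos hρ0.le hρ2) hτ0.le
    refine ⟨r, hr1, hr2, ?_⟩
    set u : Fin n → ℝ := fun k => τ * (a k + r) with hu
    have hunorm : ‖u‖ ≤ 2 * τ := by
      refine (pi_norm_le_iff_of_nonneg (by positivity)).2 fun k => ?_
      rw [hu, Real.norm_eq_abs, abs_mul, abs_of_pos hτ0, mul_comm 2]
      have h1 := ha1 k
      have h2 : |r| ≤ 1 := abs_le.2 ⟨hr1, hr2.trans zero_le_one⟩
      have := abs_add_le (a k) r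
      gcongr
      linarith
    have hΦu : eval (fun k => ((x k * Real.exp (u k) : ℝ) : ℂ)) H = 0 := by
      rw [← hρ]
      congr 2
      ext k
      have : u k = Real.log ρ + τ * a k := by
        simp only [hu, hr]
        field_simp
        ring
      rw [this, Real.exp_add, Real.exp_log hρ0]
      push_cast
      ring
    have hsmall := hball (y := u) (by
      rw [dist_zero_right]
      refine hunorm.trans_lt ?_
      rw [hτ]
      linarith)
    have hΦ0 : eval (fun k => ((x k * Real.exp ((0 : Fin n → ℝ) k) : ℝ) : ℂ)) H = 0 := by
      simpa using hHx
    rw [hΦu, hΦ0, sub_zero, sub_zero, zero_sub, norm_neg, hLu] at hsmall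
    have hsum : ∑ k, μ k * (u k : ℂ) = τ * (μ i - μ j + M * r) := by
      have h1 : ∀ k, μ k * (u k : ℂ) = τ * (μ k * (a k : ℂ)) + τ * (μ k * r) := by
        intro k
        simp only [hu]
        push_cast
        ring
      have h2 : ∑ k, μ k * (a k : ℂ) = μ i - μ j := by
        simp [ha, Pi.single_apply, mul_sub, Finset.sum_sub_distrib, apply_ite (Complex.ofReal)]
      simp only [h1, Finset.sum_add_distrib, ← Finset.mul_sum, h2, ← Finset.sum_mul]
      rw [mul_add]
    rw [hsum, norm_mul, Complex.norm_real, Real.norm_of_nonneg hτ0.le] at hsmall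
    have : τ * ‖μ i - μ j + M * r‖ ≤ τ * ε := by
      refine hsmall.trans ?_
      calc ε / 2 * ‖u‖ ≤ ε / 2 * (2 * τ) := by gcongr
        _ = τ * ε := by ring
    exact le_of_mul_le_mul_left this hτ0
  refine ⟨hHx, fun i j => sub_eq_zero.1 (norm_le_zero_iff.1 (le_of_forall_pos_le_add
    fun ε hε => ?_))⟩
  change ‖μ i - μ j‖ ≤ 0 + ε
  obtain ⟨r, -, hr, h1⟩ := key i j (ε / 3) (by positivity)
  obtain ⟨r', -, hr', h2⟩ := key j i (ε / 3) (by positivity)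
  -- Adding the estimates for `(i, j)` and `(j, i)` cancels `μ i - μ j`. Since `r` and `r'` are both
  -- nonpositive, `M * r` alone is then small as well.
  have h3 : ‖M * (r + r' : ℂ)‖ ≤ ε / 3 + ε / 3 := by
    have : M * (r + r' : ℂ) = (μ i - μ j + M * r) + (μ j - μ i + M * r') := by ring
    rw [this]
    exact (norm_add_le _ _).trans (add_le_add h1 h2)
  have h4 : ‖M * (r : ℂ)‖ ≤ ‖M * (r + r' : ℂ)‖ := by
    rw [norm_mul, norm_mul, ← Complex.ofReal_add, Complex.norm_real, Complex.norm_real,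
      Real.norm_eq_abs, Real.norm_eq_abs, abs_of_nonpos hr, abs_of_nonpos (add_nonpos hr hr')]
    gcongr
    linarith
  have h5 : ‖μ i - μ j‖ ≤ ‖μ i - μ j + M * r‖ + ‖M * (r : ℂ)‖ := by
    have : μ i - μ j = (μ i - μ j + M * r) - M * r := by ring
    conv_lhs => rw [this]
    exact norm_sub_le _ _
  linarith

/-- The hypothesis on the axes bounds the domain, so that the product of the moduli has a maximum on
its closure. The positive point with the moduli of a maximizer is the minimal critical point. -/
theorem IsCombinatorial.exists_isMinimalCriticalPoint {G H : MvPolynomial (Fin n) ℂ} (hn : 1 ≤ n)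
    (hc : IsCombinatorial G H) (hH0 : eval 0 H ≠ 0)
    (haxis : ∀ i, ∃ u : ℂ, eval (Pi.single i u) H = 0 ∧ eval (Pi.single i u) G ≠ 0) : A0 G H := by
  have hbound : ∃ b : ℝ, ∀ z ∈ domainOfConvergence G H, ∀ i, ‖z i‖ ≤ b := by
    choose u hu using haxis
    refine ⟨∑ i, ‖u i‖, fun z hz i => ?_⟩
    -- Otherwise the series would converge at the zero of `H` on the axis, where its sum times `H`
    -- equals `G ≠ 0`.
    have h1 : ‖z i‖ ≤ ‖u i‖ := by
      by_contra! hlt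
      have habs : AbsConvAt (taylorSeries G H) (Pi.single i (u i)) := by
        refine (absConvAt_of_mem hz).mono fun j => ?_
        by_cases hj : j = i
        · subst hj; simpa using hlt.le
        · simp [hj]
      have := sumAt_taylorSeries hH0 habs
      rw [(hu i).1, mul_zero] at this
      exact (hu i).2 this.symm
    exact h1.trans (Finset.single_le_sum (f := fun i => ‖u i‖) (fun _ _ => norm_nonneg _)
      (Finset.mem_univ i))
  obtain ⟨b, hb⟩ := hbound
  obtain ⟨r, hr0, hr⟩ := exists_absConvAt_taylorSeries G hH0
  have hrD : (fun _ => ((r / 2 : ℝ) : ℂ)) ∈ domainOfConvergence G H :=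
    mem_domainOfConvergence_iff.2 ⟨fun _ => r, fun i => by
      rw [Complex.norm_real, Real.norm_of_nonneg (by positivity)]
      linarith, hr⟩
  have hcompact : IsCompact (closure (domainOfConvergence G H)) := by
    refine Metric.isCompact_of_isClosed_isBounded isClosed_closure (Bornology.IsBounded.closure ?_)
    refine (Metric.isBounded_closedBall (x := (0 : Fin n → ℂ)) (r := b)).subset fun z hz => ?_
    rw [mem_closedBall_zero_iff]
    exact (pi_norm_le_iff_of_nonneg ((norm_nonneg _).trans (hb _ hrD ⟨0, hn⟩))).2 (hb z hz)
  have hcontP : Continuous fun z : Fin n → ℂ => ∏ i, ‖z i‖ := by fun_prop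
  obtain ⟨zs, hzs, hzmax⟩ := hcompact.exists_isMaxOn ⟨_, subset_closure hrD⟩ hcontP.continuousOn
  set x : Fin n → ℝ := fun i => ‖zs i‖ with hxdef
  have hmax : ∀ z ∈ domainOfConvergence G H, ∏ i, ‖z i‖ ≤ ∏ i, x i :=
    fun z hz => hzmax (subset_closure hz)
  have hx : ∀ i, 0 < x i := by
    have h1 : 0 < ∏ i, x i := by
      refine lt_of_lt_of_le ?_ (hmax _ hrD)
      refine Finset.prod_pos fun i _ => ?_
      rw [Complex.norm_real, Real.norm_of_nonneg (by positivity)]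
      positivity
    intro i
    exact (norm_nonneg _).lt_of_ne' ((Finset.prod_ne_zero_iff.1 h1.ne') i (Finset.mem_univ i))
  have hbelow : ∀ t : ℝ, 0 ≤ t → t < 1 → ∀ w : Fin n → ℂ, (∀ i, ‖w i‖ ≤ t * x i) →
      w ∈ domainOfConvergence G H := by
    intro t ht0 ht1 w hw
    have hopen : IsOpen {v : Fin n → ℂ | ∀ i, t * x i < ‖v i‖} := by
      rw [Set.ofPred_forall]
      exact isOpen_iInter_of_finite fun i =>
        isOpen_lt continuous_const (continuous_apply i).norm
    -- The domain contains points `v` near the maximizer whose moduli exceed `t * x i`, and with `v`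
    -- all points of smaller moduli.
    obtain ⟨v, hv, hvD⟩ := mem_closure_iff.1 hzs _ hopen
      fun i => mul_lt_of_lt_one_left (hx i) ht1
    exact domainOfConvergence_mono hvD fun i => (hw i).trans (hv i).le
  have hcrit := hc.isCriticalPoint hn hH0 hx hmax hbelow
  refine ⟨fun i => (x i : ℂ), ⟨⟨⟨?_, ?_⟩, hcrit.1⟩, hcrit⟩⟩
  · have hlim : Tendsto (fun t : ℝ => (fun i => ((t * x i : ℝ) : ℂ) : Fin n → ℂ)) (𝓝[<] 1)
        (𝓝 fun i => (x i : ℂ)) := by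
      have hcont : Continuous fun t : ℝ => (fun i => ((t * x i : ℝ) : ℂ) : Fin n → ℂ) :=
        continuous_pi fun i => by fun_prop
      have := hcont.tendsto 1
      simp only [one_mul] at this
      exact this.mono_left nhdsWithin_le_nhds
    refine mem_closure_of_tendsto hlim ?_
    have hpos : ∀ᶠ t : ℝ in 𝓝[<] 1, 0 < t := nhdsWithin_le_nhds (lt_mem_nhds one_pos)
    filter_upwards [hpos, self_mem_nhdsWithin] with t h1 h2
    refine hbelow t h1.le h2 _ fun i => ?_
    rw [Complex.norm_real, Real.norm_of_nonneg (mul_pos h1 (hx i)).le]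
  · rw [domainOfConvergence, interior_interior]
    intro hmem
    obtain ⟨s, hs, habs⟩ := mem_domainOfConvergence_iff.1 hmem
    have hxs : ∀ i, x i < s i := fun i => by
      have := hs i
      rwa [Complex.norm_real, Real.norm_of_nonneg (hx i).le] at this
    have hnorm : ∀ i, ‖(((x i + s i) / 2 : ℝ) : ℂ)‖ = (x i + s i) / 2 := fun i => by
      rw [Complex.norm_real, Real.norm_of_nonneg]
      have := hx i
      have := hxs i
      linarith
    -- If `x` were in the open domain, all coordinates could be enlarged at once, increasing the
    -- product beyond its maximum.
    have hy : (fun i => (((x i + s i) / 2 : ℝ) : ℂ)) ∈ domainOfConvergence G H :=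
      mem_domainOfConvergence_iff.2 ⟨s, fun i => by
        rw [hnorm]
        have := hxs i
        linarith, habs⟩
    have h1 := hmax _ hy
    simp only [hnorm] at h1
    refine absurd h1 (not_le.2 (Finset.prod_lt_prod_of_nonempty (fun i _ => hx i)
      (fun i _ => ?_) ⟨⟨0, hn⟩, Finset.mem_univ _⟩))
    have := hxs i
    linarith

/-! ### Assembly of the generic statements -/

theorem generically_of_polynomial {P : MvPolynomial (Fin n) ℂ → MvPolynomial (Fin n) ℂ → Prop}
    (h : ∀ d₁ d₂ : ℕ, 0 < d₁ → 0 < d₂ → ∃ Q : MvPolynomial (Params n d₁ d₂) ℂ, Q ≠ 0 ∧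
      ∀ G H : MvPolynomial (Fin n) ℂ, G.totalDegree = d₁ → H.totalDegree = d₂ → eval 0 H ≠ 0 →
        eval (coeffVector d₁ d₂ G H) Q ≠ 0 → P G H) : Generically n P := by
  intro d₁ d₂ hd₁ hd₂
  obtain ⟨Q, hQ0, hQ⟩ := h d₁ d₂ hd₁ hd₂
  exact ⟨_, isProperAlgebraicSubset_zeroLocus hQ0, fun G H hG hH _ hH0 hC => hQ G H hG hH hH0 hC⟩

theorem IsCriticalPoint.eq_const (hn : 1 ≤ n) {H : MvPolynomial (Fin n) ℂ} {z : Fin n → ℂ}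
    (hz : IsCriticalPoint H z) :
    ∀ i, z i * eval z (pderiv i H) = z ⟨0, hn⟩ * eval z (pderiv ⟨0, hn⟩ H) :=
  fun i => hz.2 i _

theorem generically_J1 (hn : 1 ≤ n) : Generically n fun _ H => J1 H :=
  generically_of_polynomial fun d₁ d₂ _ hd₂ => by
    obtain ⟨Q, hQ0, hQ⟩ := generic_extendedJacobian hn d₁ d₂ hd₂
    exact ⟨Q, hQ0, fun G H hG hH _ hne => (J1_iff H).2 (hQ G H hG hH hne)⟩

theorem Generically.mono {P P' : MvPolynomial (Fin n) ℂ → MvPolynomial (Fin n) ℂ → Prop}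
    (h : Generically n P) (hP : ∀ G H, P G H → P' G H) : Generically n P' := by
  intro d₁ d₂ hd₁ hd₂
  obtain ⟨C, hC, h⟩ := h d₁ d₂ hd₁ hd₂
  exact ⟨C, hC, fun G H hG hH hp hH0 hGC => hP G H (h G H hG hH hp hH0 hGC)⟩

theorem J1.isNondegenerate (hn : 1 ≤ n) {H : MvPolynomial (Fin n) ℂ} (hJ : J1 H)
    {z : Fin n → ℂ} (hz : IsCriticalPoint H z) : IsNondegenerate H z := by
  obtain ⟨h1, h2⟩ := hJ.critical hz.1 (hz.eq_const hn)
  exact isNondegenerate_of_jacobian hn hz.1 (hz.eq_const hn) h1 h2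

theorem A2_of_A0 (hn : 1 ≤ n) {G H : MvPolynomial (Fin n) ℂ}
    (h : ∀ (z : Fin n → ℂ) (l : ℂ), eval z H = 0 → (∀ i, z i * eval z (pderiv i H) = l) →
        eval z G ≠ 0) (h0 : A0 G H) : A2 G H := by
  obtain ⟨z, hz⟩ := h0
  exact ⟨z, hz, h z _ hz.2.1 (hz.2.eq_const hn)⟩

theorem generically_combinatorial (hn : 1 ≤ n) :
    Generically n fun G H => IsCombinatorial G H → A0 G H ∧ A2 G H :=
  generically_of_polynomial fun d₁ d₂ _ hd₂ => by
    obtain ⟨Q, hQ0, hQ⟩ := generic_numerator_ne_zero (n := n) d₁ d₂ hd₂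
    choose A hA0 hA using generic_axis (n := n) d₁ d₂
    choose B hB0 hB using generic_pure_power (n := n) d₁ d₂
    -- The product defines the union of the exceptional sets: `B i` ensures that `H` has a zero on
    -- the `i`-th axis, `A i` that `G` does not vanish there, `Q` that (A0) implies (A2).
    refine ⟨Q * ∏ i, (A i * B i), mul_ne_zero hQ0 (Finset.prod_ne_zero_iff.2 fun i _ =>
      mul_ne_zero (hA0 i) (hB0 i)), fun G H hG hH hH0 hne hc => ?_⟩
    rw [map_mul, map_prod] at hne
    have hi : ∀ i, eval (coeffVector d₁ d₂ G H) (A i * B i) ≠ 0 := fun i =>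
      Finset.prod_ne_zero_iff.1 (right_ne_zero_of_mul hne) i (Finset.mem_univ i)
    have h0 : A0 G H := hc.exists_isMinimalCriticalPoint hn hH0 fun i => by
      have h := hi i
      rw [map_mul] at h
      obtain ⟨u, hu⟩ := exists_root_on_axis i hd₂ (hB i G H (right_ne_zero_of_mul h))
      exact ⟨u, hu, hA i G H hG hH (left_ne_zero_of_mul h) u hu⟩
    exact ⟨h0, A2_of_A0 hn (hQ G H hG hH (left_ne_zero_of_mul hne)) h0⟩

theorem generically_A2 (hn : 1 ≤ n) : Generically n fun G H => A0 G H → A2 G H :=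
  generically_of_polynomial fun d₁ d₂ _ hd₂ => by
    obtain ⟨Q, hQ0, hQ⟩ := generic_numerator_ne_zero (n := n) d₁ d₂ hd₂
    exact ⟨Q, hQ0, fun G H hG hH _ hne => A2_of_A0 hn (hQ G H hG hH hne)⟩

end ACSV

end

theorem mainTheorem4 (n : ℕ) (hn : 1 ≤ n) :
    ACSV.Generically n (fun G H => ACSV.A1 G H) ∧
    ACSV.Generically n (fun G H => ACSV.A0 G H → ACSV.A2 G H) ∧
    ACSV.Generically n (fun G H => ACSV.A3 G H) ∧
    ACSV.Generically n (fun _ H => ACSV.J1 H) ∧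
    ACSV.Generically n (fun G H => ACSV.IsCombinatorial G H → ACSV.A0 G H ∧ ACSV.A2 G H) := by
  refine ⟨?_, ACSV.generically_A2 hn, ?_, ACSV.generically_J1 hn,
    ACSV.generically_combinatorial hn⟩
  · exact (ACSV.generically_J1 hn).mono fun G H hJ z hz => (hJ.isNondegenerate hn hz.2).1
  · exact (ACSV.generically_J1 hn).mono fun G H hJ z hz => hJ.isNondegenerate hn hz.2
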